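/- **Conventions.** Products, sums and commutators of unbounded operators are taken on their natural domains (for example $\mathrm{Dom}(PQ)=\{x\in\mathrm{Dom}\,Q: Qx\in\mathrm{Dom}\,P\}$). For a densely defined operator $D$ put $\langle D\rangle^2=\tfrac12(DD^*+D^*D)$, meaning the closure of this operator on $\mathrm{Dom}(DD^*)\cap\mathrm{Dom}(D^*D)$. By $(1+L)^{-1/2}$ we mean a bounded positive operator $S$ on the whole space such that $S^2$ is a two-sided inverse of $1+L$. "$[D,a]$ is bounded" means that the bounded operator $a$ maps $\mathrm{Dom}\,D$ into itself and $[D,a]$ extends to a bounded operator. A *Lorentzian spectral triple* $(\mathcal A,\widetilde{\mathcal A},\mathcal H,D,\mathcal J)$ consists of a complex Hilbert space $\mathcal H$; a unital complex $*$-algebra $\widetilde{\mathcal A}$ with a faithful unital $*$-representation by bounded operators on $\mathcal H$ (which makes it a pre-$C^*$-algebra for the operator norm); a $*$-closed two-sided ideal $\mathcal A\subset\widetilde{\mathcal A}$ which has no identity element; a densely defined operator $D$ on $\mathcal H$; and a bounded operator $\mathcal J$ on $\mathcal H$, such that 1. $[D,a]$ is bounded for all $a\in\widetilde{\mathcal A}$;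 2. $(1+\langle D\rangle^2)^{-1/2}$ exists and $a(1+\langle D\rangle^2)^{-1/2}$ is compact for all $a\in\mathcal A$; 3. $\mathcal J^2=1$, $\mathcal J^*=\mathcal J$, $[\mathcal J,a]=0$ for all $a\in\widetilde{\mathcal A}$, and $D^*=-\mathcal J D\mathcal J$; 4. there is a *time operator*, that is, a self-adjoint (in general unbounded) operator $\mathcal T$ on $\mathcal H$ such that $(1+\mathcal T^2)^{-1/2}\in\widetilde{\mathcal A}$ and $\mathcal J=-[D,\mathcal T]$, in the sense that $[D,\mathcal T]$ is densely defined and agrees with $-\mathcal J$ on its domain. It is *even*, with grading $\gamma$, if $\gamma$ is a bounded operator with $\gamma^*=\gamma$, $\gamma^2=1$, $[\gamma,a]=0$ for all $a\in\widetilde{\mathcal A}$, $\gamma\mathcal J=-\mathcal J\gamma$ and $\gamma D=-D\gamma$. A *compact Riemannian spectral triple* $(\mathcal A_F,\mathcal H_F,D_F)$ consists of a complex Hilbert space $\mathcal H_F\neq0$, a unital complex $*$-algebra $\mathcal A_F$ with a faithful unital $*$-representation by bounded operators on $\mathcal H_F$, and a self-adjoint operator $D_F$ such that $[D_F,b]$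 is bounded for all $b\in\mathcal A_F$ and $(1+D_F^2)^{-1/2}$ is compact. **Theorem.** Let $(\mathcal A_M,\widetilde{\mathcal A}_M,\mathcal H_M,D_M,\mathcal J_M)$ be an even Lorentzian spectral triple with grading $\gamma_M$, and let $\mathcal T_M$ be a time operator of it which commutes with the grading, $\gamma_M\mathcal T_M=\mathcal T_M\gamma_M$. Let $(\mathcal A_F,\mathcal H_F,D_F)$ be a compact Riemannian spectral triple. Put $$\mathcal A=\mathcal A_M\otimes\mathcal A_F,\quad \widetilde{\mathcal A}=\widetilde{\mathcal A}_M\otimes\mathcal A_F,\quad \mathcal H=\mathcal H_M\otimes\mathcal H_F,\quad D=D_M\otimes1+\gamma_M\otimes D_F,\quad \mathcal J=\mathcal J_M\otimes1,$$ where the tensor products of algebras are algebraic, $\mathcal H$ is the Hilbert space tensor product, $\widetilde{\mathcal A}$ is represented on $\mathcal H$ by $a\otimes b\mapsto a\otimes b$, and $D$ is the closure of the displayed operator on the algebraic tensor product $\mathrm{Dom}\,D_M\otimes\mathrm{Dom}\,D_F$. Then $(\mathcal A,\widetilde{\mathcal A},\mathcal H,D,\mathcal J)$ is a Lorentzian spectral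 triple, and (the closure of) $\mathcal T_M\otimes1$ is a time operator of it; in particular $\mathcal J=-[D,\mathcal T_M\otimes1]$. -/

import Mathlib

open scoped TensorProduct

noncomputable section

/-! ## Unbounded operators

An unbounded operator is a partially defined linear map `H →ₗ.[ℂ] H`. Sums, differences, multiples
and adjoints are those of Mathlib; in particular sums live on the intersection of the domains. -/

section Unbounded

variable {H : Type*} [NormedAddCommGroup H] [InnerProductSpace ℂ H]

/-- The product `g f` of two unbounded operators, on its natural domain
`{x ∈ Dom f | f x ∈ Dom g}`. -/
def opComp (g f : H →ₗ.[ℂ] H) : H →ₗ.[ℂ] H where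
  domain :=
    { carrier := {x | ∃ h : x ∈ f.domain, f ⟨x, h⟩ ∈ g.domain}
      add_mem' := by
        rintro x y ⟨hx, hx'⟩ ⟨hy, hy'⟩
        exact ⟨add_mem hx hy, by
          have : f ⟨x + y, add_mem hx hy⟩ = f ⟨x, hx⟩ + f ⟨y, hy⟩ := f.map_add ⟨x, hx⟩ ⟨y, hy⟩
          rw [this]; exact add_mem hx' hy'⟩
      zero_mem' := ⟨zero_mem _, by
        have : f ⟨0, zero_mem _⟩ = 0 := f.map_zero
        rw [this]; exact zero_mem _⟩
      smul_mem' := by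
        rintro c x ⟨hx, hx'⟩
        exact ⟨Submodule.smul_mem _ c hx, by
          have : f ⟨c • x, Submodule.smul_mem _ c hx⟩ = c • f ⟨x, hx⟩ := f.map_smul c ⟨x, hx⟩
          rw [this]; exact Submodule.smul_mem _ c hx'⟩ }
  toFun :=
    { toFun := fun x => g ⟨f ⟨x.1, x.2.1⟩, x.2.2⟩
      map_add' := by
        intro x y
        rw [← LinearPMap.map_add]
        congr 1
        exact Subtype.ext (f.map_add ⟨x.1, x.2.1⟩ ⟨y.1, y.2.1⟩)
      map_smul' := by
        intro c x
        rw [RingHom.id_apply, ← LinearPMap.map_smul]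
        congr 1
        exact Subtype.ext (f.map_smul c ⟨x.1, x.2.1⟩) }

/-- A bounded operator, viewed as an everywhere defined element of `H →ₗ.[ℂ] H`. -/
def bddOp (a : H →L[ℂ] H) : H →ₗ.[ℂ] H :=
  (a : H →ₗ[ℂ] H).toPMap ⊤

/-- The commutator `[P, Q] = P Q - Q P`, on the natural domain of the right hand side. -/
def opComm (P Q : H →ₗ.[ℂ] H) : H →ₗ.[ℂ] H :=
  opComp P Q - opComp Q P

/-- `[D, a]` extends to a bounded operator on `H`: the bounded operator `a` maps `Dom D` into itself
(so that `[D, a]` is defined on all of `Dom D`), and `[D, a]` agrees there with a bounded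
operator. -/
def HasBoundedCommutator (D : H →ₗ.[ℂ] H) (a : H →L[ℂ] H) : Prop :=
  (∀ x ∈ D.domain, a x ∈ D.domain) ∧
    ∃ C : H →L[ℂ] H, ∀ x : (opComm D (bddOp a)).domain, opComm D (bddOp a) x = C x

/-- `S = (1 + L)^(-1/2)`: the operator `S` is bounded and positive, and `S²` is a two-sided inverse
of `1 + L`. -/
def IsInvSqrtOneAdd (L : H →ₗ.[ℂ] H) (S : H →L[ℂ] H) : Prop :=
  S.IsPositive ∧
    (∀ x : H, ∃ h : S (S x) ∈ L.domain, S (S x) + L ⟨S (S x), h⟩ = x) ∧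
    (∀ x : L.domain, S (S ((x : H) + L x)) = x)

/-- `⟨D⟩² = ½ (D D* + D* D)`: the closure of the operator with the natural domain
`Dom (D D*) ∩ Dom (D* D)`. -/
def angleSq [CompleteSpace H] (D : H →ₗ.[ℂ] H) : H →ₗ.[ℂ] H :=
  ((1 / 2 : ℂ) • (opComp D D.adjoint + opComp D.adjoint D)).closure

end Unbounded

/-! ## Lorentzian and Riemannian spectral triples -/

/-- The data `(𝒜, 𝒜~, H, D, 𝒥)`. The type `B` is the unitisation `𝒜~`, a unital `*`-algebra
represented on `H` by `π`, and `𝒜` is a subspace of it, represented by the restriction of `π`. When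
`π` is faithful, `‖π a‖` is a (not necessarily complete) C⋆-norm, which makes `𝒜` and `𝒜~`
pre-C⋆-algebras. -/
structure LorentzianData (B H : Type*) [Ring B] [StarRing B] [Algebra ℂ B]
    [NormedAddCommGroup H] [InnerProductSpace ℂ H] [CompleteSpace H] where
  /-- the non-unital algebra, inside its unitisation `B` -/
  A : Submodule ℂ B
  /-- the representation of `B` as bounded operators -/
  π : B →⋆ₐ[ℂ] (H →L[ℂ] H)
  /-- the Dirac operator -/
  D : H →ₗ.[ℂ] H
  /-- the fundamental symmetry -/
  J : H →L[ℂ] H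

namespace LorentzianData

variable {B H : Type*} [Ring B] [StarRing B] [Algebra ℂ B]
  [NormedAddCommGroup H] [InnerProductSpace ℂ H] [CompleteSpace H]

/-- `T` is a self-adjoint operator with `(1 + T²)^(-1/2) ∈ 𝒜~` and `𝒥 = -[D, T]`, that is, `[D, T]`
is densely defined and equal to `-𝒥` on its domain. -/
structure IsTimeOperator (X : LorentzianData B H) (T : H →ₗ.[ℂ] H) : Prop where
  selfAdjoint : IsSelfAdjoint T
  inv_sqrt_mem : ∃ t : B, IsInvSqrtOneAdd (opComp T T) (X.π t)
  dense_comm : Dense ((opComm X.D T).domain : Set H)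
  J_eq : ∀ x : (opComm X.D T).domain, X.J x = -(opComm X.D T x)

/-- The axioms of a Lorentzian spectral triple. -/
structure IsLorentzianSpectralTriple (X : LorentzianData B H) : Prop where
  faithful : Function.Injective X.π
  star_mem : ∀ a ∈ X.A, star a ∈ X.A
  ideal : ∀ a ∈ X.A, ∀ b : B, a * b ∈ X.A ∧ b * a ∈ X.A
  nonunital : ¬ ∃ e ∈ X.A, ∀ a ∈ X.A, e * a = a ∧ a * e = a
  dense_domain : Dense (X.D.domain : Set H)
  bounded_comm : ∀ a : B, HasBoundedCommutator X.D (X.π a)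
  compact_resolvent : ∃ S : H →L[ℂ] H, IsInvSqrtOneAdd (angleSq X.D) S ∧
    ∀ a ∈ X.A, IsCompactOperator (X.π a ∘L S)
  J_sq : X.J * X.J = 1
  J_adjoint : ContinuousLinearMap.adjoint X.J = X.J
  J_comm : ∀ a : B, Commute X.J (X.π a)
  D_adjoint : X.D.adjoint = -(opComp (bddOp X.J) (opComp X.D (bddOp X.J)))
  time : ∃ T : H →ₗ.[ℂ] H, X.IsTimeOperator T

/-- `γ` is a `ℤ₂`-grading, making the triple even. -/
structure IsGrading (X : LorentzianData B H) (γ : H →L[ℂ] H) : Prop where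
  adjoint_eq : ContinuousLinearMap.adjoint γ = γ
  sq : γ * γ = 1
  comm : ∀ a : B, Commute γ (X.π a)
  anticomm_J : γ * X.J = -(X.J * γ)
  anticomm_D : opComp (bddOp γ) X.D = -(opComp X.D (bddOp γ))

end LorentzianData

/-- The data `(𝒜_F, H_F, D_F)`, where the type `C` is the unital `*`-algebra `𝒜_F`. -/
structure RiemannianData (C K : Type*) [Ring C] [StarRing C] [Algebra ℂ C]
    [NormedAddCommGroup K] [InnerProductSpace ℂ K] [CompleteSpace K] where
  /-- the representation as bounded operators -/
  π : C →⋆ₐ[ℂ] (K →L[ℂ] K)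
  /-- the Dirac operator -/
  D : K →ₗ.[ℂ] K

/-- The axioms of a compact (that is, unital) Riemannian spectral triple. -/
structure RiemannianData.IsCompactSpectralTriple {C K : Type*} [Ring C] [StarRing C] [Algebra ℂ C]
    [NormedAddCommGroup K] [InnerProductSpace ℂ K] [CompleteSpace K]
    (Y : RiemannianData C K) : Prop where
  faithful : Function.Injective Y.π
  selfAdjoint : IsSelfAdjoint Y.D
  bounded_comm : ∀ b : C, HasBoundedCommutator Y.D (Y.π b)
  compact_resolvent : ∃ S : K →L[ℂ] K, IsInvSqrtOneAdd (opComp Y.D Y.D) S ∧ IsCompactOperator S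

/-! ## Tensor products -/

section Tensor

variable {H K : Type*} [NormedAddCommGroup H] [InnerProductSpace ℂ H]
  [NormedAddCommGroup K] [InnerProductSpace ℂ K]

variable (H K) in
/-- The Hilbert space tensor product: the completion of the algebraic one. -/
def HilbertTensor : Type _ := UniformSpace.Completion (H ⊗[ℂ] K)

instance : NormedAddCommGroup (HilbertTensor H K) :=
  inferInstanceAs (NormedAddCommGroup (UniformSpace.Completion (H ⊗[ℂ] K)))

instance : InnerProductSpace ℂ (HilbertTensor H K) :=
  inferInstanceAs (InnerProductSpace ℂ (UniformSpace.Completion (H ⊗[ℂ] K)))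

instance : CompleteSpace (HilbertTensor H K) :=
  inferInstanceAs (CompleteSpace (UniformSpace.Completion (H ⊗[ℂ] K)))

variable (H K) in
/-- The inclusion of the algebraic tensor product in the Hilbert space tensor product. -/
def toHilbertTensor : H ⊗[ℂ] K →ₗᵢ[ℂ] HilbertTensor H K :=
  UniformSpace.Completion.toComplₗᵢ (𝕜 := ℂ) (E := H ⊗[ℂ] K)

theorem toHilbertTensor_denseRange : DenseRange (toHilbertTensor H K) :=
  UniformSpace.Completion.denseRange_coe

/-- The bounded operator `a ⊗ b` on the Hilbert space tensor product. -/
def tensorOp (a : H →L[ℂ] H) (b : K →L[ℂ] K) : HilbertTensor H K →L[ℂ] HilbertTensor H K :=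
  (TensorProduct.mapL a b).completion

theorem tensorOp_coe (a : H →L[ℂ] H) (b : K →L[ℂ] K) (z : H ⊗[ℂ] K) :
    tensorOp a b (toHilbertTensor H K z) =
      toHilbertTensor H K (TensorProduct.map (a : H →ₗ[ℂ] H) (b : K →ₗ[ℂ] K) z) :=
  ((TensorProduct.mapL a b).completion_apply_coe z).trans (by
    rw [TensorProduct.mapL_apply]; rfl)

theorem tensorOp_ext {f g : HilbertTensor H K →L[ℂ] HilbertTensor H K}
    (h : ∀ (x : H) (y : K), f (toHilbertTensor H K (x ⊗ₜ[ℂ] y)) =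
      g (toHilbertTensor H K (x ⊗ₜ[ℂ] y))) : f = g := by
  have key : ∀ z : H ⊗[ℂ] K, f (toHilbertTensor H K z) = g (toHilbertTensor H K z) := by
    intro z
    induction z with
    | zero => simp
    | tmul x y => exact h x y
    | add x y hx hy => rw [map_add, map_add, map_add, hx, hy]
  ext z
  exact toHilbertTensor_denseRange.induction_on (p := fun z => f z = g z) z
    (isClosed_eq f.continuous g.continuous) key

theorem tensorOp_adjoint [CompleteSpace H] [CompleteSpace K] (a : H →L[ℂ] H) (b : K →L[ℂ] K) :
    ContinuousLinearMap.adjoint (tensorOp a b) =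
      tensorOp (ContinuousLinearMap.adjoint a) (ContinuousLinearMap.adjoint b) := by
  symm
  rw [ContinuousLinearMap.eq_adjoint_iff]
  intro u v
  induction u, v using toHilbertTensor_denseRange.induction_on₂ with
  | hp => exact isClosed_eq (by fun_prop) (by fun_prop)
  | h u v =>
    rw [tensorOp_coe, tensorOp_coe, LinearIsometry.inner_map_map, LinearIsometry.inner_map_map]
    induction u with
    | zero => simp
    | add x y hx hy => simp only [map_add, inner_add_left, hx, hy]
    | tmul x y =>
      induction v with
      | zero => simp
      | add z w hz hw => simp only [map_add, inner_add_right, hz, hw]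
      | tmul z w => simp [ContinuousLinearMap.adjoint_inner_left]

/-- The inclusion of the algebraic tensor product `Dom P ⊗ Dom Q`. -/
def domIncl (P : H →ₗ.[ℂ] H) (Q : K →ₗ.[ℂ] K) :
    P.domain ⊗[ℂ] Q.domain →ₗ[ℂ] HilbertTensor H K :=
  (toHilbertTensor H K).toLinearMap ∘ₗ
    TensorProduct.mapIncl P.domain Q.domain

theorem domIncl_injective (P : H →ₗ.[ℂ] H) (Q : K →ₗ.[ℂ] K) :
    Function.Injective (domIncl P Q) := by
  refine (toHilbertTensor H K).injective.comp ?_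
  exact TensorProduct.map_injective_of_flat_flat _ _ (Submodule.injective_subtype _)
    (Submodule.injective_subtype _)

/-- The operator `P ⊗ Q`, `x ⊗ y ↦ P x ⊗ Q y`, on the algebraic tensor product
`Dom P ⊗ Dom Q`. -/
def algTensor (P : H →ₗ.[ℂ] H) (Q : K →ₗ.[ℂ] K) : HilbertTensor H K →ₗ.[ℂ] HilbertTensor H K where
  domain := LinearMap.range (domIncl P Q)
  toFun := (toHilbertTensor H K).toLinearMap ∘ₗ
    TensorProduct.map P.toFun Q.toFun ∘ₗ
      (LinearEquiv.ofInjective (domIncl P Q) (domIncl_injective P Q)).symm.toLinearMap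

end Tensor

section TensorRep

variable {B H C K : Type*} [Ring B] [StarRing B] [Algebra ℂ B] [StarModule ℂ B]
  [NormedAddCommGroup H] [InnerProductSpace ℂ H] [CompleteSpace H]
  [Ring C] [StarRing C] [Algebra ℂ C] [StarModule ℂ C]
  [NormedAddCommGroup K] [InnerProductSpace ℂ K] [CompleteSpace K]

/-- The representation `a ⊗ b ↦ π(a) ⊗ ρ(b)` of the algebraic tensor product on the Hilbert space
tensor product. -/
def tensorRep (π : B →⋆ₐ[ℂ] (H →L[ℂ] H)) (ρ : C →⋆ₐ[ℂ] (K →L[ℂ] K)) :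
    (B ⊗[ℂ] C) →⋆ₐ[ℂ] (HilbertTensor H K →L[ℂ] HilbertTensor H K) :=
  let φ : (B ⊗[ℂ] C) →ₐ[ℂ] (HilbertTensor H K →L[ℂ] HilbertTensor H K) :=
    Algebra.TensorProduct.algHomOfLinearMapTensorProduct
      (TensorProduct.lift (LinearMap.mk₂ ℂ (fun a b => tensorOp (π a) (ρ b))
        (fun a a' b => tensorOp_ext fun x y => by
          simp [tensorOp_coe, TensorProduct.add_tmul])
        (fun c a b => tensorOp_ext fun x y => by
          simp [tensorOp_coe, ← TensorProduct.smul_tmul'])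
        (fun a b b' => tensorOp_ext fun x y => by
          simp [tensorOp_coe, TensorProduct.tmul_add])
        (fun c a b => tensorOp_ext fun x y => by
          simp [tensorOp_coe])))
      (fun a a' b b' => tensorOp_ext fun x y => by
        simp [tensorOp_coe])
      (tensorOp_ext fun x y => by
        simp [tensorOp_coe])
  { φ with
    map_star' := by
      intro z
      change φ (star z) = star (φ z)
      induction z with
      | zero => simp
      | add x y hx hy => rw [star_add, map_add, map_add, star_add, hx, hy]
      | tmul a b =>
        simp [φ, map_star, ContinuousLinearMap.star_eq_adjoint, tensorOp_adjoint] }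

theorem tensorRep_tmul (π : B →⋆ₐ[ℂ] (H →L[ℂ] H)) (ρ : C →⋆ₐ[ℂ] (K →L[ℂ] K)) (a : B) (b : C) :
    tensorRep π ρ (a ⊗ₜ[ℂ] b) = tensorOp (π a) (ρ b) := rfl

/-- The product of `(𝒜, 𝒜~, H, D, 𝒥)`, with grading `γ`, and `(𝒜_F, H_F, D_F)`:
`𝒜 ⊗ 𝒜_F` (inside `𝒜~ ⊗ 𝒜_F`), `𝒜~ ⊗ 𝒜_F`, `H ⊗ H_F`, `D ⊗ 1 + γ ⊗ D_F`, `𝒥 ⊗ 1`, where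
`D ⊗ 1 + γ ⊗ D_F` is the closure of the operator on `Dom D ⊗ Dom D_F`. -/
def LorentzianData.prod (X : LorentzianData B H) (γ : H →L[ℂ] H) (Y : RiemannianData C K) :
    LorentzianData (B ⊗[ℂ] C) (HilbertTensor H K) where
  A := LinearMap.range (TensorProduct.map X.A.subtype (LinearMap.id : C →ₗ[ℂ] C))
  π := tensorRep X.π Y.π
  D := (algTensor X.D (bddOp 1) + algTensor (bddOp γ) Y.D).closure
  J := tensorOp X.J 1

end TensorRep

end

/-! The second factor is diagonalised. Since `F.D` is self-adjoint with compact resolvent, `K` has a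
Hilbert basis of eigenvectors `e i` with real eigenvalues `l i`, only finitely many of them in any
bounded interval (`exists_eigenbasis`). The product space is the Hilbert sum of the copies `H ⊗ e i`
of `H`, and on the `i`-th copy the product Dirac operator is `D + l i • γ`, a bounded perturbation
of the closed operator `D = M.D` (`graph_closure_algTensor_add`). The analytic axioms other than
bounded commutators are then read off on each summand.

As `γ` is self-adjoint and `l i` is real, the adjoint is `D* + l i • γ` on each summand, and this
equals `-J (D + l i • γ) J` because `γ` anticommutes with `J`. Moreover `γ` anticommutes with both
`D` and `D*`, so the cross terms in `⟨D + l i • γ⟩²` cancel and `⟨D⟩² + (l i)²` remains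
(`angleSq_graph_eq_sumGraph`). If `S = (1 + ⟨D⟩²)^(-1/2)`, the inverse square root on the `i`-th
summand is `S (1 + (l i)² S²)^(-1/2)`, which is compact after multiplication by `a` in the ideal and
has norm at most `1 / |l i|` when `l i ≠ 0`. The decay makes the whole operator a norm limit of
compact ones (`isCompactOperator_tensorOp_diagonal`).

The time operator acts as `T` on every summand; it commutes with `γ`, so `[D + l i • γ, T]` reduces
to `[D, T]`. Commutators with the algebra are computed on the algebraic tensor product and pass to
the closure. Faithfulness and the absence of an identity follow by slice maps.

Operators are handled through their graphs, so that domain conditions travel with the equations. -/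

noncomputable section

/-! ### Unbounded operators through their graphs -/

section Graph

variable {H : Type*} [NormedAddCommGroup H] [InnerProductSpace ℂ H]

theorem mem_graph_opComp {f g : H →ₗ.[ℂ] H} {x z : H} :
    (x, z) ∈ (opComp g f).graph ↔ ∃ y, (x, y) ∈ f.graph ∧ (y, z) ∈ g.graph := by
  simp only [LinearPMap.mem_graph_iff, Subtype.exists]
  constructor
  · rintro ⟨a, ⟨h, h'⟩, rfl, rfl⟩
    exact ⟨_, ⟨a, h, rfl, rfl⟩, _, h', rfl, rfl⟩
  · rintro ⟨y, ⟨a, h, rfl, rfl⟩, b, h', rfl, rfl⟩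
    exact ⟨a, ⟨h, h'⟩, rfl, rfl⟩

theorem mem_graph_bddOp {a : H →L[ℂ] H} {x y : H} : (x, y) ∈ (bddOp a).graph ↔ y = a x := by
  simp only [LinearPMap.mem_graph_iff, Subtype.exists]
  constructor
  · rintro ⟨_, _, rfl, rfl⟩
    rfl
  · rintro rfl
    exact ⟨x, trivial, rfl, rfl⟩

theorem mem_graph_add {f g : H →ₗ.[ℂ] H} {x z : H} :
    (x, z) ∈ (f + g).graph ↔ ∃ a b, (x, a) ∈ f.graph ∧ (x, b) ∈ g.graph ∧ z = a + b := by
  simp only [LinearPMap.mem_graph_iff, Subtype.exists]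
  constructor
  · rintro ⟨y, ⟨h, h'⟩, rfl, rfl⟩
    exact ⟨_, _, ⟨y, h, rfl, rfl⟩, ⟨y, h', rfl, rfl⟩, rfl⟩
  · rintro ⟨_, _, ⟨y, h, rfl, rfl⟩, ⟨_, h', rfl, rfl⟩, rfl⟩
    exact ⟨_, ⟨h, h'⟩, rfl, rfl⟩

theorem mem_graph_sub {f g : H →ₗ.[ℂ] H} {x z : H} :
    (x, z) ∈ (f - g).graph ↔ ∃ a b, (x, a) ∈ f.graph ∧ (x, b) ∈ g.graph ∧ z = a - b := by
  simp only [LinearPMap.mem_graph_iff, Subtype.exists]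
  constructor
  · rintro ⟨y, ⟨h, h'⟩, rfl, rfl⟩
    exact ⟨_, _, ⟨y, h, rfl, rfl⟩, ⟨y, h', rfl, rfl⟩, rfl⟩
  · rintro ⟨_, _, ⟨y, h, rfl, rfl⟩, ⟨_, h', rfl, rfl⟩, rfl⟩
    exact ⟨_, ⟨h, h'⟩, rfl, rfl⟩

theorem mem_graph_neg {f : H →ₗ.[ℂ] H} {x z : H} : (x, z) ∈ (-f).graph ↔ (x, -z) ∈ f.graph := by
  simp only [LinearPMap.mem_graph_iff, Subtype.exists]
  constructor
  · rintro ⟨y, h, rfl, rfl⟩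
    exact ⟨y, h, rfl, (neg_neg _).symm⟩
  · rintro ⟨y, h, rfl, h'⟩
    exact ⟨y, h, rfl, by rw [← neg_neg z, ← h']; rfl⟩

theorem mem_graph_smul {f : H →ₗ.[ℂ] H} {c : ℂ} {x z : H} :
    (x, z) ∈ (c • f).graph ↔ ∃ y, (x, y) ∈ f.graph ∧ z = c • y := by
  simp only [LinearPMap.mem_graph_iff, Subtype.exists]
  constructor
  · rintro ⟨y, h, rfl, rfl⟩
    exact ⟨_, ⟨y, h, rfl, rfl⟩, rfl⟩
  · rintro ⟨_, ⟨y, h, rfl, rfl⟩, rfl⟩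
    exact ⟨y, h, rfl, rfl⟩

theorem mem_graph_opComm {P Q : H →ₗ.[ℂ] H} {x z : H} :
    (x, z) ∈ (opComm P Q).graph ↔ ∃ a b c d, (x, a) ∈ Q.graph ∧ (a, b) ∈ P.graph ∧
      (x, c) ∈ P.graph ∧ (c, d) ∈ Q.graph ∧ z = b - d := by
  simp only [opComm, mem_graph_sub, mem_graph_opComp]
  constructor
  · rintro ⟨b, d, ⟨a, h₁, h₂⟩, ⟨c, h₃, h₄⟩, rfl⟩
    exact ⟨a, b, c, d, h₁, h₂, h₃, h₄, rfl⟩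
  · rintro ⟨a, b, c, d, h₁, h₂, h₃, h₄, rfl⟩
    exact ⟨b, d, ⟨a, h₁, h₂⟩, ⟨c, h₃, h₄⟩, rfl⟩

theorem LinearPMap.forall_apply_iff_graph {E F : Type*} [AddCommGroup E] [Module ℂ E]
    [AddCommGroup F] [Module ℂ F] {f : E →ₗ.[ℂ] F} {p : E → F → Prop} :
    (∀ x : f.domain, p x (f x)) ↔ ∀ x y, (x, y) ∈ f.graph → p x y := by
  constructor
  · intro h x y hxy
    obtain ⟨z, rfl, rfl⟩ := f.mem_graph_iff.1 hxy
    exact h z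
  · exact fun h x => h _ _ (f.mem_graph x)

theorem hasBoundedCommutator_iff {D : H →ₗ.[ℂ] H} {a : H →L[ℂ] H} :
    HasBoundedCommutator D a ↔
      ∃ C : H →L[ℂ] H, ∀ x y, (x, y) ∈ D.graph → (a x, a y + C x) ∈ D.graph := by
  unfold HasBoundedCommutator
  constructor
  · rintro ⟨h, C, hC⟩
    refine ⟨C, fun x y hxy => ?_⟩
    rw [LinearPMap.forall_apply_iff_graph (p := fun x y => y = C x)] at hC
    obtain ⟨w, hw⟩ := LinearPMap.mem_domain_iff.1 (h x (LinearPMap.mem_domain_of_mem_graph hxy))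
    have := hC x (w - a y) (mem_graph_opComm.2
      ⟨a x, w, y, a y, mem_graph_bddOp.2 rfl, hw, hxy, mem_graph_bddOp.2 rfl, rfl⟩)
    rwa [← this, add_sub_cancel]
  · rintro ⟨C, hC⟩
    refine ⟨fun x hx => ?_, C, ?_⟩
    · obtain ⟨y, hxy⟩ := LinearPMap.mem_domain_iff.1 hx
      exact LinearPMap.mem_domain_of_mem_graph (hC x y hxy)
    · rw [LinearPMap.forall_apply_iff_graph (p := fun x y => y = C x)]
      intro x z hz
      obtain ⟨b, c, d, e, hb, hc, hd, he, rfl⟩ := mem_graph_opComm.1 hz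
      rw [mem_graph_bddOp] at hb he
      subst hb he
      rw [D.mem_graph_snd_inj hc (hC x d hd) rfl, add_sub_cancel_left]

theorem isInvSqrtOneAdd_iff {L : H →ₗ.[ℂ] H} {S : H →L[ℂ] H} :
    IsInvSqrtOneAdd L S ↔ S.IsPositive ∧ (∀ x, (S (S x), x - S (S x)) ∈ L.graph) ∧
      ∀ x y, (x, y) ∈ L.graph → S (S (x + y)) = x := by
  unfold IsInvSqrtOneAdd
  refine and_congr_right fun _ => and_congr (forall_congr' fun x => ?_) ?_
  · simp only [LinearPMap.mem_graph_iff, Subtype.exists, eq_sub_iff_add_eq']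
    constructor
    · rintro ⟨h, h'⟩
      exact ⟨_, h, rfl, h'⟩
    · rintro ⟨_, h, rfl, h'⟩
      exact ⟨h, h'⟩
  · exact LinearPMap.forall_apply_iff_graph (p := fun x y => S (S (x + y)) = x)

/-- An operator `L` for which `1 + L` has a bounded two-sided inverse is closed. -/
theorem IsInvSqrtOneAdd.isClosed {L : H →ₗ.[ℂ] H} {S : H →L[ℂ] H} (h : IsInvSqrtOneAdd L S) :
    L.IsClosed := by
  obtain ⟨-, h₁, h₂⟩ := isInvSqrtOneAdd_iff.1 h
  have : (L.graph : Set (H × H)) = {p | S (S (p.1 + p.2)) = p.1} := by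
    ext ⟨x, y⟩
    refine ⟨h₂ x y, fun hxy => ?_⟩
    have := h₁ (x + y)
    rw [Set.mem_ofPred_eq] at hxy
    rwa [hxy, add_sub_cancel_left] at this
  rw [LinearPMap.IsClosed, this]
  exact isClosed_eq (by fun_prop) (by fun_prop)

/-- The `closure` of a non-closable operator is by convention the operator itself. It is then not
closed, so closedness of `f.closure` rules this default value out. -/
theorem LinearPMap.closure_graph_eq_of_isClosed {f : H →ₗ.[ℂ] H} (h : f.closure.IsClosed) :
    f.closure.graph = f.graph.topologicalClosure := by
  by_cases hf : f.IsClosable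
  · exact hf.graph_closure_eq_closure_graph.symm
  · rw [closure_def' hf] at h
    exact absurd h.isClosable hf

/-- The two inclusions make `G` the closure of the graph; being single-valued, it is the graph of an
operator, which witnesses that `f` is closable. -/
theorem LinearPMap.closure_graph_eq {f : H →ₗ.[ℂ] H} {G : Submodule ℂ (H × H)}
    (hG : _root_.IsClosed (G : Set (H × H))) (hG₀ : ∀ y, (0, y) ∈ G → y = 0)
    (hf : f.graph ≤ G) (hf' : G ≤ f.graph.topologicalClosure) : f.closure.graph = G := by
  have h := le_antisymm (f.graph.topologicalClosure_minimal hf hG) hf'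
  have hfc : f.IsClosable := ⟨G.toLinearPMap, by
    rw [h, Submodule.toLinearPMap_graph_eq]
    rintro ⟨x, y⟩ hx (rfl : x = 0)
    exact hG₀ y hx⟩
  rw [← hfc.graph_closure_eq_closure_graph, h]

theorem LinearPMap.adjoint_graph_mem_iff [CompleteSpace H] {f : H →ₗ.[ℂ] H}
    (hf : Dense (f.domain : Set H)) {x y : H} :
    (x, y) ∈ f.adjoint.graph ↔ ∀ a b, (a, b) ∈ f.graph → inner ℂ b x = inner ℂ a y := by
  simp only [adjoint_graph_eq_graph_adjoint hf, Submodule.mem_adjoint_iff, sub_eq_zero]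

end Graph

/-! ### Hilbert sums: coordinates, diagonal operators, sums of graphs -/

section HilbertSum

variable {ι H E : Type*} [NormedAddCommGroup H] [InnerProductSpace ℂ H] [CompleteSpace H]
  [NormedAddCommGroup E] [InnerProductSpace ℂ E] [CompleteSpace E] {V : ι → H →ₗᵢ[ℂ] E}

/-- The coordinate `V i ^*` of a Hilbert sum. -/
def coord (V : ι → H →ₗᵢ[ℂ] E) (i : ι) : E →L[ℂ] H :=
  ContinuousLinearMap.adjoint (V i).toContinuousLinearMap

theorem inner_coord_left (i : ι) (z : E) (x : H) :
    inner ℂ (coord V i z) x = inner ℂ z (V i x) :=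
  ContinuousLinearMap.adjoint_inner_left _ _ _

theorem inner_coord_right (i : ι) (z : E) (x : H) :
    inner ℂ x (coord V i z) = inner ℂ (V i x) z :=
  ContinuousLinearMap.adjoint_inner_right _ _ _

theorem coord_self (i : ι) (x : H) : coord V i (V i x) = x :=
  ext_inner_right ℂ fun y => by rw [inner_coord_left, LinearIsometry.inner_map_map]

namespace IsHilbertSum

variable (hV : IsHilbertSum ℂ (fun _ => H) V)
include hV

theorem coord_of_ne {i j : ι} (h : i ≠ j) (x : H) : coord V i (V j x) = 0 :=
  ext_inner_right ℂ fun y => by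
    rw [inner_coord_left, hV.OrthogonalFamily h.symm, inner_zero_left]

theorem linearIsometryEquiv_eq_coord (z : E) (i : ι) :
    hV.linearIsometryEquiv z i = coord V i z := by
  classical
  refine ext_inner_left ℂ fun x : H => ?_
  refine (lp.inner_single_left (𝕜 := ℂ) (G := fun _ => H) i x _).symm.trans ?_
  rw [inner_coord_right, ← hV.linearIsometryEquiv.symm.inner_map_map, LinearIsometryEquiv.symm_apply_apply,
    hV.linearIsometryEquiv_symm_apply_single]

theorem ext_coord {z w : E} (h : ∀ i, coord V i z = coord V i w) : z = w := by
  apply hV.linearIsometryEquiv.injective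
  ext i
  rw [hV.linearIsometryEquiv_eq_coord, hV.linearIsometryEquiv_eq_coord, h]

theorem hasSum_inner_coord (z w : E) :
    HasSum (fun i => inner ℂ (coord V i z) (coord V i w)) (inner ℂ z w) := by
  have := lp.hasSum_inner (𝕜 := ℂ) (hV.linearIsometryEquiv z) (hV.linearIsometryEquiv w)
  simpa only [hV.linearIsometryEquiv_eq_coord, LinearIsometryEquiv.inner_map_map] using this

theorem hasSum_coord (z : E) : HasSum (fun i => V i (coord V i z)) z := by
  have := hV.hasSum_linearIsometryEquiv_symm (hV.linearIsometryEquiv z)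
  simpa only [hV.linearIsometryEquiv_eq_coord, LinearIsometryEquiv.symm_apply_apply] using this

theorem exists_coord_eq {y : ι → H} (hy : Summable fun i => ‖y i‖ ^ 2) :
    ∃ z : E, ∀ i, coord V i z = y i := by
  have hy' : Memℓp y 2 := memℓp_gen (by simpa using hy)
  refine ⟨hV.linearIsometryEquiv.symm ⟨y, hy'⟩, fun i => ?_⟩
  rw [← hV.linearIsometryEquiv_eq_coord, LinearIsometryEquiv.apply_symm_apply]

/-- A uniformly bounded family of operators acts diagonally on a Hilbert sum. -/
theorem exists_diagonal {R : ι → H →L[ℂ] H} {c : ℝ} (hc : 0 ≤ c) (hR : ∀ i, ‖R i‖ ≤ c) :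
    ∃ A : E →L[ℂ] E, ∀ i z, coord V i (A z) = R i (coord V i z) := by
  refine ⟨(hV.linearIsometryEquiv.symm : lp (fun _ => H) 2 →L[ℂ] E) ∘L
    lp.mapCLM 2 R hc hR ∘L (hV.linearIsometryEquiv : E →L[ℂ] lp (fun _ => H) 2), fun i z => ?_⟩
  rw [← hV.linearIsometryEquiv_eq_coord, ← hV.linearIsometryEquiv_eq_coord]
  simp

theorem norm_diagonal_le {R : ι → H →L[ℂ] H} {c : ℝ} (hc : 0 ≤ c) (hR : ∀ i, ‖R i‖ ≤ c)
    {A : E →L[ℂ] E} (hA : ∀ i z, coord V i (A z) = R i (coord V i z)) : ‖A‖ ≤ c := by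
  refine A.opNorm_le_bound hc fun z => ?_
  have h : lp.mapCLM 2 R hc hR (hV.linearIsometryEquiv z) = hV.linearIsometryEquiv (A z) := by
    ext i
    rw [hV.linearIsometryEquiv_eq_coord, hA, ← hV.linearIsometryEquiv_eq_coord]
    simp
  rw [← hV.linearIsometryEquiv.norm_map, ← h, ← hV.linearIsometryEquiv.norm_map z]
  exact ContinuousLinearMap.le_of_opNorm_le _ (lp.norm_mapCLM_le 2 R hc hR) _

theorem isPositive_of_diagonal {R : ι → H →L[ℂ] H} (hR : ∀ i, (R i).IsPositive)
    {A : E →L[ℂ] E} (hA : ∀ i z, coord V i (A z) = R i (coord V i z)) : A.IsPositive := by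
  refine ContinuousLinearMap.isPositive_def.2 ⟨fun z w => ?_, fun z => ?_⟩
  · refine (hV.hasSum_inner_coord _ _).unique ?_
    convert! hV.hasSum_inner_coord z (A w) using 2 with i
    rw [ContinuousLinearMap.coe_coe, hA, hA]
    exact (hR i).isSymmetric _ _
  · refine (Complex.hasSum_re (hV.hasSum_inner_coord (A z) z)).nonneg fun i => ?_
    rw [hA]
    exact (hR i).re_inner_nonneg_left _

end IsHilbertSum

/-- The graph of the direct sum of the operators with graphs `G i`. -/
def sumGraph (V : ι → H →ₗᵢ[ℂ] E) (G : ι → Submodule ℂ (H × H)) : Submodule ℂ (E × E) :=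
  ⨅ i, (G i).comap ((coord V i : E →ₗ[ℂ] H).prodMap (coord V i : E →ₗ[ℂ] H))

theorem mem_sumGraph {G : ι → Submodule ℂ (H × H)} {z w : E} :
    (z, w) ∈ sumGraph V G ↔ ∀ i, (coord V i z, coord V i w) ∈ G i := by
  simp [sumGraph]

theorem isClosed_sumGraph {G : ι → Submodule ℂ (H × H)} (hG : ∀ i, IsClosed (G i : Set (H × H))) :
    IsClosed (sumGraph V G : Set (E × E)) := by
  rw [sumGraph, Submodule.coe_iInf]
  refine isClosed_iInter fun i => (hG i).preimage ?_
  exact ((coord V i).continuous.comp continuous_fst).prodMk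
    ((coord V i).continuous.comp continuous_snd)

namespace IsHilbertSum

variable (hV : IsHilbertSum ℂ (fun _ => H) V)
include hV

theorem map_mem_sumGraph {G : ι → Submodule ℂ (H × H)} {i : ι} {x y : H} (h : (x, y) ∈ G i) :
    (V i x, V i y) ∈ sumGraph V G := by
  refine mem_sumGraph.2 fun j => ?_
  by_cases hj : j = i
  · subst hj
    rwa [coord_self, coord_self]
  · rw [hV.coord_of_ne hj, hV.coord_of_ne hj]
    exact zero_mem _

/-- Testing against vectors of a single summand gives one inclusion, Parseval's identity the other.
No density is needed, as the `G i` are arbitrary linear relations. -/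
theorem adjoint_sumGraph (G : ι → Submodule ℂ (H × H)) :
    (sumGraph V G).adjoint = sumGraph V fun i => (G i).adjoint := by
  ext ⟨z, w⟩
  simp only [mem_sumGraph, Submodule.mem_adjoint_iff, sub_eq_zero]
  constructor
  · intro h i a b hab
    rw [inner_coord_right, inner_coord_right]
    exact h _ _ (mem_sumGraph.1 (hV.map_mem_sumGraph hab))
  · intro h a b hab
    refine (hV.hasSum_inner_coord b z).unique ?_
    convert! hV.hasSum_inner_coord a w using 2 with i
    exact h i _ _ (hab i)

theorem sumGraph_le_topologicalClosure {G : ι → Submodule ℂ (H × H)} {P : Submodule ℂ (E × E)}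
    (h : ∀ i x y, (x, y) ∈ G i → (V i x, V i y) ∈ P.topologicalClosure) :
    sumGraph V G ≤ P.topologicalClosure := by
  rintro ⟨z, w⟩ hzw
  refine IsClosed.mem_of_tendsto P.isClosed_topologicalClosure
    ((hV.hasSum_coord z).prodMk (hV.hasSum_coord w)) (Filter.Eventually.of_forall fun s => ?_)
  exact sum_mem fun i _ => h i _ _ (mem_sumGraph.1 hzw i)

/-- This is the tool for identifying a closure with a direct sum: every pair in the sum is the limit
of its finite partial sums, so it suffices to approximate pairs supported in one summand. -/
theorem closure_graph_eq_sumGraph {P : E →ₗ.[ℂ] E} {G : ι → Submodule ℂ (H × H)}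
    (hG : ∀ i, IsClosed (G i : Set (H × H))) (hG₀ : ∀ i y, (0, y) ∈ G i → y = 0)
    (hP : P.graph ≤ sumGraph V G)
    (hP' : ∀ i x y, (x, y) ∈ G i → (V i x, V i y) ∈ P.graph.topologicalClosure) :
    P.closure.graph = sumGraph V G := by
  refine LinearPMap.closure_graph_eq (isClosed_sumGraph hG) (fun y hy => ?_) hP
    (hV.sumGraph_le_topologicalClosure hP')
  refine hV.ext_coord fun i => ?_
  have := mem_sumGraph.1 hy i
  rw [map_zero] at this ⊢
  exact hG₀ i _ this

theorem dense_of_map_mem {W : Submodule ℂ E} {U : ι → Set H} (hU : ∀ i, Dense (U i))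
    (h : ∀ i, ∀ x ∈ U i, V i x ∈ W) : Dense (W : Set E) := by
  have key : ∀ i x, V i x ∈ W.topologicalClosure := fun i x =>
    (hU i).induction (P := fun x => V i x ∈ W.topologicalClosure)
      (fun x hx => W.le_topologicalClosure (h i x hx))
      (W.isClosed_topologicalClosure.preimage (V i).continuous) x
  refine W.dense_iff_topologicalClosure_eq_top.2 (eq_top_iff.2 fun z _ => ?_)
  exact IsClosed.mem_of_tendsto W.isClosed_topologicalClosure (hV.hasSum_coord z)
    (Filter.Eventually.of_forall fun s => sum_mem fun i _ => key i _)

end IsHilbertSum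

end HilbertSum

/-! ### The tensor product as a Hilbert sum over a basis of the second factor -/

section TensorCoord

variable {H K : Type*} [NormedAddCommGroup H] [InnerProductSpace ℂ H]
  [NormedAddCommGroup K] [InnerProductSpace ℂ K]

theorem norm_toHilbertTensor_tmul (x : H) (y : K) :
    ‖toHilbertTensor H K (x ⊗ₜ[ℂ] y)‖ = ‖x‖ * ‖y‖ := by
  rw [LinearIsometry.norm_map, TensorProduct.norm_tmul]

theorem inner_toHilbertTensor_tmul (x x' : H) (y y' : K) :
    inner ℂ (toHilbertTensor H K (x ⊗ₜ[ℂ] y)) (toHilbertTensor H K (x' ⊗ₜ[ℂ] y')) =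
      inner ℂ x x' * inner ℂ y y' := by
  rw [LinearIsometry.inner_map_map, TensorProduct.inner_tmul]

/-- The bounded operator `x ↦ x ⊗ y`. -/
def tmulRight (H : Type*) [NormedAddCommGroup H] [InnerProductSpace ℂ H] (y : K) :
    H →L[ℂ] HilbertTensor H K :=
  LinearMap.mkContinuous ((toHilbertTensor H K).toLinearMap ∘ₗ (TensorProduct.mk ℂ H K).flip y) ‖y‖
    fun x => by
      change ‖toHilbertTensor H K (x ⊗ₜ[ℂ] y)‖ ≤ _
      rw [norm_toHilbertTensor_tmul, mul_comm]

theorem continuous_toHilbertTensor_tmul (x : H) :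
    Continuous fun y : K => toHilbertTensor H K (x ⊗ₜ[ℂ] y) :=
  (toHilbertTensor H K).continuous.comp
    (TensorProduct.continuous_tmul.comp (Continuous.prodMk continuous_const continuous_id))

theorem topologicalClosure_eq_top_of_tmul_mem {W : Submodule ℂ (HilbertTensor H K)}
    (h : ∀ x y, toHilbertTensor H K (x ⊗ₜ[ℂ] y) ∈ W.topologicalClosure) :
    W.topologicalClosure = ⊤ := by
  refine eq_top_iff.2 fun z _ => ?_
  refine toHilbertTensor_denseRange.induction_on
    (p := fun z => z ∈ W.topologicalClosure) z W.isClosed_topologicalClosure fun z => ?_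
  induction z with
  | zero => rw [map_zero]; exact zero_mem _
  | tmul x y => exact h x y
  | add x y hx hy => rw [map_add]; exact add_mem hx hy

/-- The isometries `x ↦ x ⊗ e i` attached to a Hilbert basis `e` of the second factor. -/
def basisIncl (H : Type*) [NormedAddCommGroup H] [InnerProductSpace ℂ H] {ι : Type*}
    (e : HilbertBasis ι ℂ K) (i : ι) : H →ₗᵢ[ℂ] HilbertTensor H K where
  toLinearMap := (tmulRight H (e i)).toLinearMap
  norm_map' x := by
    change ‖toHilbertTensor H K (x ⊗ₜ[ℂ] e i)‖ = _
    rw [norm_toHilbertTensor_tmul, e.orthonormal.1, mul_one]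

variable {ι : Type*} (e : HilbertBasis ι ℂ K)

theorem basisIncl_apply (i : ι) (x : H) :
    basisIncl H e i x = toHilbertTensor H K (x ⊗ₜ[ℂ] e i) := rfl

variable [CompleteSpace H]

theorem isHilbertSum_basisIncl : IsHilbertSum ℂ (fun _ => H) (basisIncl H e) := by
  refine IsHilbertSum.mk (fun i j hij x y => ?_)
    (eq_top_iff.1 (topologicalClosure_eq_top_of_tmul_mem fun x y => ?_))
  · rw [basisIncl_apply, basisIncl_apply, inner_toHilbertTensor_tmul, e.orthonormal.2 hij, mul_zero]
  · set W := ⨆ i, LinearMap.range (basisIncl H e i).toLinearMap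
    have hd : Dense (Submodule.span ℂ (Set.range e) : Set K) :=
      Submodule.dense_iff_topologicalClosure_eq_top.2 e.dense_span
    refine hd.induction (P := fun y => toHilbertTensor H K (x ⊗ₜ[ℂ] y) ∈ W.topologicalClosure)
      (fun y hy => W.le_topologicalClosure ?_)
      (W.isClosed_topologicalClosure.preimage (continuous_toHilbertTensor_tmul x)) y
    induction hy using Submodule.span_induction with
    | mem y hy =>
      obtain ⟨i, rfl⟩ := hy
      exact Submodule.mem_iSup_of_mem i ⟨x, rfl⟩
    | zero => rw [TensorProduct.tmul_zero, map_zero]; exact zero_mem _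
    | add y z _ _ hy hz => rw [TensorProduct.tmul_add, map_add]; exact add_mem hy hz
    | smul c y _ hy => rw [TensorProduct.tmul_smul, map_smul]; exact W.smul_mem c hy

theorem coord_basisIncl_tmul (i : ι) (x : H) (y : K) :
    coord (basisIncl H e) i (toHilbertTensor H K (x ⊗ₜ[ℂ] y)) = inner ℂ (e i) y • x :=
  ext_inner_left ℂ fun w => by
    rw [inner_coord_right, basisIncl_apply, inner_toHilbertTensor_tmul, inner_smul_right, mul_comm]

theorem coord_basisIncl_tensorOp_one [CompleteSpace K] (i : ι) (a : H →L[ℂ] H)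
    (z : HilbertTensor H K) :
    coord (basisIncl H e) i (tensorOp a 1 z) = a (coord (basisIncl H e) i z) := by
  refine ext_inner_left ℂ fun w => ?_
  rw [inner_coord_right, ← ContinuousLinearMap.adjoint_inner_left, tensorOp_adjoint,
    ← ContinuousLinearMap.adjoint_inner_left, inner_coord_right, basisIncl_apply, tensorOp_coe,
    basisIncl_apply, ContinuousLinearMap.one_def, ContinuousLinearMap.adjoint_id]
  rfl

end TensorCoord

/-! ### Operators on algebraic tensor products of domains -/

section AlgTensor

variable {H K : Type*} [NormedAddCommGroup H] [InnerProductSpace ℂ H]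
  [NormedAddCommGroup K] [InnerProductSpace ℂ K] {P : H →ₗ.[ℂ] H} {Q : K →ₗ.[ℂ] K}

theorem mem_graph_algTensor {z w : HilbertTensor H K} :
    (z, w) ∈ (algTensor P Q).graph ↔ ∃ t : P.domain ⊗[ℂ] Q.domain, z = domIncl P Q t ∧
      w = toHilbertTensor H K (TensorProduct.map P.toFun Q.toFun t) := by
  simp only [LinearPMap.mem_graph_iff, Subtype.exists]
  constructor
  · rintro ⟨_, ⟨t, rfl⟩, rfl, rfl⟩
    refine ⟨t, rfl, ?_⟩
    change toHilbertTensor H K (TensorProduct.map P.toFun Q.toFun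
      ((LinearEquiv.ofInjective (domIncl P Q) (domIncl_injective P Q)).symm
        (LinearEquiv.ofInjective (domIncl P Q) (domIncl_injective P Q) t))) = _
    rw [LinearEquiv.symm_apply_apply]
  · rintro ⟨t, rfl, rfl⟩
    refine ⟨_, ⟨t, rfl⟩, rfl, ?_⟩
    change toHilbertTensor H K (TensorProduct.map P.toFun Q.toFun
      ((LinearEquiv.ofInjective (domIncl P Q) (domIncl_injective P Q)).symm
        (LinearEquiv.ofInjective (domIncl P Q) (domIncl_injective P Q) t))) = _
    rw [LinearEquiv.symm_apply_apply]

theorem tmul_mem_graph_algTensor {x x' : H} {y y' : K} (hx : (x, x') ∈ P.graph)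
    (hy : (y, y') ∈ Q.graph) :
    (toHilbertTensor H K (x ⊗ₜ[ℂ] y), toHilbertTensor H K (x' ⊗ₜ[ℂ] y')) ∈
      (algTensor P Q).graph := by
  obtain ⟨x, rfl, rfl⟩ := P.mem_graph_iff.1 hx
  obtain ⟨y, rfl, rfl⟩ := Q.mem_graph_iff.1 hy
  exact mem_graph_algTensor.2 ⟨x ⊗ₜ y, rfl, rfl⟩

theorem graph_algTensor_le {G : Submodule ℂ (HilbertTensor H K × HilbertTensor H K)}
    (h : ∀ x x' y y', (x, x') ∈ P.graph → (y, y') ∈ Q.graph →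
      (toHilbertTensor H K (x ⊗ₜ[ℂ] y), toHilbertTensor H K (x' ⊗ₜ[ℂ] y')) ∈ G) :
    (algTensor P Q).graph ≤ G := by
  rintro ⟨z, w⟩ hzw
  obtain ⟨t, rfl, rfl⟩ := mem_graph_algTensor.1 hzw
  induction t with
  | zero =>
    rw [map_zero, map_zero, map_zero]
    exact zero_mem _
  | tmul x y => exact h _ _ _ _ (P.mem_graph x) (Q.mem_graph y)
  | add s t hs ht =>
    rw [map_add, map_add, map_add]
    exact add_mem (hs (mem_graph_algTensor.2 ⟨s, rfl, rfl⟩))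
      (ht (mem_graph_algTensor.2 ⟨t, rfl, rfl⟩))

end AlgTensor

/-! ### Diagonalisation of a self-adjoint operator with compact resolvent -/

section Eigenbasis

universe u

variable {K : Type*} [NormedAddCommGroup K] [InnerProductSpace ℂ K]

/-- The eigenspace of an unbounded operator. -/
def pmapEigenspace (D : K →ₗ.[ℂ] K) (l : ℝ) : Submodule ℂ K :=
  D.graph.comap (LinearMap.id.prod ((l : ℂ) • LinearMap.id))

theorem mem_pmapEigenspace {D : K →ₗ.[ℂ] K} {l : ℝ} {x : K} :
    x ∈ pmapEigenspace D l ↔ (x, (l : ℂ) • x) ∈ D.graph := Iff.rfl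

theorem isClosed_pmapEigenspace {D : K →ₗ.[ℂ] K} (hD : D.IsClosed) (l : ℝ) :
    IsClosed (pmapEigenspace D l : Set K) :=
  hD.preimage (f := fun x : K => (x, (l : ℂ) • x)) (by fun_prop)

theorem IsSelfAdjoint.inner_graph [CompleteSpace K] {D : K →ₗ.[ℂ] K} (hD : IsSelfAdjoint D)
    {x x' y y' : K} (hx : (x, x') ∈ D.graph) (hy : (y, y') ∈ D.graph) :
    inner ℂ x' y = inner ℂ x y' := by
  rw [← hD] at hy
  exact (LinearPMap.adjoint_graph_mem_iff hD.dense_domain).1 hy _ _ hx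

theorem orthogonalFamily_pmapEigenspace [CompleteSpace K] {D : K →ₗ.[ℂ] K}
    (hD : IsSelfAdjoint D) :
    OrthogonalFamily ℂ (fun l => pmapEigenspace D l) fun l => (pmapEigenspace D l).subtypeₗᵢ := by
  rintro l m hlm ⟨x, hx⟩ ⟨y, hy⟩
  have h := hD.inner_graph hx hy
  change inner ℂ ((l : ℂ) • x) y = inner ℂ x ((m : ℂ) • y) at h
  rw [inner_smul_left, inner_smul_right, Complex.conj_ofReal, ← sub_eq_zero, ← sub_mul] at h
  refine (mul_eq_zero.1 h).resolve_left ?_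
  rw [sub_eq_zero]
  exact_mod_cast hlm

/-- An eigenvector of the square of a self-adjoint operator is a combination of eigenvectors. -/
theorem mem_iSup_pmapEigenspace_of_sq [CompleteSpace K] {D : K →ₗ.[ℂ] K} (hD : IsSelfAdjoint D)
    {c : ℂ} {x : K} (hx : (x, c • x) ∈ (opComp D D).graph) : x ∈ ⨆ l, pmapEigenspace D l := by
  obtain ⟨u, hu, hu'⟩ := mem_graph_opComp.1 hx
  by_cases hx₀ : x = 0
  · rw [hx₀]; exact zero_mem _
  have hn : (‖x‖ : ℂ) ^ 2 ≠ 0 := by simpa using hx₀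
  have h := hD.inner_graph hu' hu
  rw [inner_smul_left, inner_self_eq_norm_sq_to_K, inner_self_eq_norm_sq_to_K] at h
  -- With `u = D x`, self-adjointness gives `conj c * ‖x‖² = ‖u‖²`, so `c` is the square of the real
  -- number `‖u‖ / ‖x‖`.
  obtain ⟨s, hs, rfl⟩ : ∃ s : ℝ, s * ‖x‖ = ‖u‖ ∧ c = (s : ℂ) ^ 2 := by
    refine ⟨‖u‖ / ‖x‖, div_mul_cancel₀ _ (norm_ne_zero_iff.2 hx₀), ?_⟩
    have h' : (starRingEnd ℂ) c = ((‖u‖ / ‖x‖ : ℝ) : ℂ) ^ 2 := by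
      rw [Complex.ofReal_div, div_pow, eq_div_iff hn]
      exact h
    rw [← Complex.conj_conj c, h', ← Complex.ofReal_pow, Complex.conj_ofReal]
  by_cases hs₀ : s = 0
  · subst hs₀
    rw [zero_mul, eq_comm, norm_eq_zero] at hs
    subst hs
    refine Submodule.mem_iSup_of_mem 0 (mem_pmapEigenspace.2 ?_)
    simpa using hu
  -- Since `D u = s² x`, the vectors `u ± s x` are eigenvectors for `± s` (or zero), and their
  -- difference is `2 s x`.
  · have hp : u + (s : ℂ) • x ∈ ⨆ l, pmapEigenspace D l := by
      refine Submodule.mem_iSup_of_mem s (mem_pmapEigenspace.2 ?_)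
      convert! D.graph.add_mem hu' (D.graph.smul_mem (s : ℂ) hu) using 1
      ext1 <;> simp only [Prod.fst_add, Prod.snd_add, Prod.smul_mk]
      module
    have hm : u - (s : ℂ) • x ∈ ⨆ l, pmapEigenspace D l := by
      refine Submodule.mem_iSup_of_mem (-s) (mem_pmapEigenspace.2 ?_)
      convert! D.graph.sub_mem hu' (D.graph.smul_mem (s : ℂ) hu) using 1
      ext1 <;> simp only [Prod.fst_sub, Prod.snd_sub, Prod.smul_mk, Complex.ofReal_neg]
      module
    have hs' : (2 * s : ℂ) ≠ 0 := mul_ne_zero two_ne_zero (Complex.ofReal_ne_zero.2 hs₀)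
    refine (Submodule.smul_mem_iff _ hs').1 ?_
    convert! sub_mem hp hm using 1
    module

/-- Orthogonality gives `‖R (e i) - R (e j)‖² = (m i)² + (m j)²`, so images with `m i, m j ≥ ε` are
more than `ε` apart. Finitely many balls of radius `ε / 2` cover the image of the unit ball, and
each holds at most one of them. -/
theorem finite_setOf_le_eigenvalue {R : K →L[ℂ] K} (hR : IsCompactOperator R) {ι : Type*}
    {e : ι → K} (he : Orthonormal ℂ e) {m : ι → ℝ} (hm : ∀ i, R (e i) = (m i : ℂ) • e i)
    {ε : ℝ} (hε : 0 < ε) : {i | ε ≤ m i}.Finite := by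
  obtain ⟨Q, hQ, hRQ⟩ := hR.image_closedBall_subset_compact (f := (R : K →ₗ[ℂ] K)) 1
  obtain ⟨t, -, ht, hQt⟩ := hQ.finite_cover_balls (half_pos hε)
  have hmem : ∀ i, ∃ y ∈ t, R (e i) ∈ Metric.ball y (ε / 2) := fun i => by
    have : R (e i) ∈ Q := hRQ ⟨e i, by simp [he.1 i], rfl⟩
    simpa using hQt this
  choose f hft hf using hmem
  refine Set.Finite.of_injOn (f := f) (fun i _ => hft i) (fun i hi j hj hij => ?_) ht
  by_contra hne
  have h₁ : ‖R (e i) - R (e j)‖ < ε := by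
    rw [← dist_eq_norm]
    have hj' := hf j
    rw [← hij] at hj'
    calc _ ≤ dist (R (e i)) (f i) + dist (R (e j)) (f i) := dist_triangle_right _ _ _
      _ < ε / 2 + ε / 2 := add_lt_add (hf i) hj'
      _ = ε := add_halves ε
  have h₂ : ‖R (e i) - R (e j)‖ * ‖R (e i) - R (e j)‖ = m i * m i + m j * m j := by
    rw [hm, hm, norm_sub_mul_self (𝕜 := ℂ), inner_smul_left, inner_smul_right, he.2 hne]
    simp [norm_smul, he.1]
  have hi' : ε ≤ m i := hi
  nlinarith [norm_nonneg (R (e i) - R (e j)), mul_self_nonneg (m j)]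

/-- A self-adjoint operator with compact resolvent has a Hilbert basis of eigenvectors, and its
eigenvalues tend to infinity. -/
theorem exists_eigenbasis {K : Type u} [NormedAddCommGroup K] [InnerProductSpace ℂ K]
    [CompleteSpace K] {D : K →ₗ.[ℂ] K} (hD : IsSelfAdjoint D) {S : K →L[ℂ] K}
    (hS : IsInvSqrtOneAdd (opComp D D) S) (hSc : IsCompactOperator S) :
    ∃ (ι : Type u) (e : HilbertBasis ι ℂ K) (l : ι → ℝ),
      (∀ i, (e i, (l i : ℂ) • e i) ∈ D.graph) ∧ ∀ c, {i | |l i| ≤ c}.Finite := by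
  obtain ⟨hSp, hS₁, hS₂⟩ := isInvSqrtOneAdd_iff.1 hS
  have hRc : IsCompactOperator (S ∘L S) := hSc.comp_clm S
  have hRs : ((S ∘L S : K →L[ℂ] K) : K →ₗ[ℂ] K).IsSymmetric := fun x y => by
    simp only [ContinuousLinearMap.coe_coe, ContinuousLinearMap.comp_apply]
    exact (hSp.isSymmetric _ _).trans (hSp.isSymmetric _ _)
  -- The spectral theorem is applied to the compact operator `S² = (1 + D²)⁻¹`. An eigenvector for
  -- `μ ≠ 0` is one of `D²` for `μ⁻¹ - 1`; the value `μ = 0` is excluded because `S²` is injective.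
  have htop : (⨆ l, pmapEigenspace D l)ᗮ = ⊥ := by
    rw [← le_bot_iff, ← ContinuousLinearMap.orthogonalComplement_iSup_eigenspaces_eq_bot hRc hRs]
    refine Submodule.orthogonal_le (iSup_le fun μ x hx => ?_)
    have hx' : S (S x) = μ • x := Module.End.mem_eigenspace_iff.1 hx
    have h := hS₁ x
    rw [hx'] at h
    by_cases hμ : μ = 0
    · rw [hμ, zero_smul, sub_zero] at h
      rw [LinearPMap.graph_fst_eq_zero_snd _ h rfl]
      exact zero_mem _
    · refine mem_iSup_pmapEigenspace_of_sq hD (c := μ⁻¹ - 1) ?_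
      convert! (opComp D D).graph.smul_mem μ⁻¹ h using 1
      ext1
      · simp [smul_smul, inv_mul_cancel₀ hμ]
      · simp [smul_smul, inv_mul_cancel₀ hμ, smul_sub, sub_smul]
  have hcl := fun l => isClosed_pmapEigenspace hD.isClosed l
  have hcomp : ∀ l, CompleteSpace (pmapEigenspace D l) := fun l => (hcl l).completeSpace_coe
  choose w b hb using fun l => exists_hilbertBasis ℂ (pmapEigenspace D l)
  have hv := (orthogonalFamily_pmapEigenspace hD).orthonormal_sigma_orthonormal
    (fun l => (b l).orthonormal)
  have hspan : (Submodule.span ℂ (Set.range fun a : Σ l, w l =>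
      ((b a.1 a.2 : pmapEigenspace D a.1) : K)))ᗮ = ⊥ := by
    rw [← le_bot_iff, ← htop]
    intro z hz
    refine (Submodule.mem_orthogonal' _ _).2 fun x hx => ?_
    rw [← Submodule.mem_orthogonal_singleton_iff_inner_right]
    revert x
    change (⨆ l, pmapEigenspace D l) ≤ _
    refine iSup_le fun l x hx => ?_
    rw [Submodule.mem_orthogonal_singleton_iff_inner_right]
    have hd : Dense (Submodule.span ℂ (Set.range (b l)) : Set (pmapEigenspace D l)) :=
      Submodule.dense_iff_topologicalClosure_eq_top.2 (b l).dense_span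
    refine hd.induction (P := fun y : pmapEigenspace D l => inner ℂ z (y : K) = 0) ?_
      (isClosed_eq (by fun_prop) continuous_const) ⟨x, hx⟩
    intro y hy
    induction hy using Submodule.span_induction with
    | mem y hy =>
      obtain ⟨i, rfl⟩ := hy
      have hi : ((b l i : pmapEigenspace D l) : K) ∈ Submodule.span ℂ (Set.range fun a : Σ l, w l =>
          ((b a.1 a.2 : pmapEigenspace D a.1) : K)) := Submodule.subset_span ⟨⟨l, i⟩, rfl⟩
      exact Submodule.inner_left_of_mem_orthogonal hi hz
    | zero => simp
    | add y y' _ _ hy hy' => rw [Submodule.coe_add, inner_add_right, hy, hy', add_zero]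
    | smul c y _ hy => rw [Submodule.coe_smul, inner_smul_right, hy, mul_zero]
  let e : HilbertBasis (Σ l, w l) ℂ K := HilbertBasis.mkOfOrthogonalEqBot hv hspan
  have he : ∀ i : Σ l, w l, e i = (b i.1 i.2 : pmapEigenspace D i.1) := fun i =>
    congrFun (HilbertBasis.coe_mkOfOrthogonalEqBot hv hspan) i
  have hDe : ∀ i : Σ l, w l, (e i, (i.1 : ℂ) • e i) ∈ D.graph := fun i => by
    rw [he]
    exact (b i.1 i.2).2
  refine ⟨_, e, fun i : Σ l, w l => i.1, hDe, fun c => ?_⟩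
  have hRe : ∀ i : Σ l, w l, (S ∘L S) (e i) = (((1 + i.1 ^ 2)⁻¹ : ℝ) : ℂ) • e i := fun i => by
    have h := hS₂ _ _ (mem_graph_opComp.2 ⟨_, hDe i, D.graph.smul_mem (i.1 : ℂ) (hDe i)⟩)
    have hne : (1 + (i.1 : ℂ) ^ 2) ≠ 0 := by
      have : (0 : ℝ) < 1 + i.1 ^ 2 := by positivity
      exact_mod_cast this.ne'
    have h' : e i + (i.1 : ℂ) • (i.1 : ℂ) • e i = (1 + (i.1 : ℂ) ^ 2) • e i := by module
    change S (S (e i + (i.1 : ℂ) • (i.1 : ℂ) • e i)) = e i at h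
    rw [h', map_smul, map_smul] at h
    push_cast
    rw [eq_inv_smul_iff₀ hne]
    exact h
  -- The bound `|l| ≤ c` forces the eigenvalue `(1 + l²)⁻¹` of `S²` to be at least `(1 + c²)⁻¹`.
  refine (finite_setOf_le_eigenvalue hRc e.orthonormal hRe
    (ε := (1 + c ^ 2)⁻¹) (by positivity)).subset fun i hi => ?_
  have hi' : |i.1| ≤ c := hi
  have hsq : i.1 ^ 2 ≤ c ^ 2 := sq_le_sq.2 (hi'.trans (le_abs_self c))
  change (1 + c ^ 2)⁻¹ ≤ (1 + i.1 ^ 2)⁻¹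
  exact inv_anti₀ (by positivity) (by linarith)

end Eigenbasis

/-! ### The inverse square root after adding a scalar square -/

section InvSqrt

variable {H : Type*} [NormedAddCommGroup H] [InnerProductSpace ℂ H] [CompleteSpace H]

/-- `S (1 + l² S²)^(-1/2)`, written as `S W`. -/
theorem ContinuousLinearMap.IsPositive.exists_invSqrt_shift {S : H →L[ℂ] H} (hS : S.IsPositive)
    (l : ℝ) :
    ∃ W : H →L[ℂ] H, (S * W).IsPositive ∧ ‖S * W‖ ≤ ‖S‖ ∧ |l| * ‖S * W‖ ≤ 1 ∧
      (S * W) * (S * W) = S * S * (W * W) ∧ (S * W) * (S * W) = W * W * (S * S) ∧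
      W * W + ((l : ℂ) ^ 2) • (S * S * (W * W)) = 1 := by
  have hsa : IsSelfAdjoint S := hS.isSelfAdjoint
  have hS0 : 0 ≤ S := (ContinuousLinearMap.nonneg_iff_isPositive S).2 hS
  have hd : ∀ s : ℝ, 0 < 1 + l ^ 2 * s ^ 2 := fun s => by positivity
  have hr : ∀ s : ℝ, 0 < √(1 + l ^ 2 * s ^ 2) := fun s => Real.sqrt_pos.2 (hd s)
  have hw : Continuous fun s : ℝ => (√(1 + l ^ 2 * s ^ 2))⁻¹ :=
    Continuous.inv₀ (by fun_prop) fun s => (hr s).ne'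
  -- If `S² = (1 + L)⁻¹`, then `(1 + L + l²)⁻¹ = S² (1 + l² S²)⁻¹`. Hence the choice `W = w(S)`; the
  -- bounds come from `w ≤ 1` and `|l s| w(s) ≤ 1`.
  set w : ℝ → ℝ := fun s => (√(1 + l ^ 2 * s ^ 2))⁻¹ with hwdef
  set W := cfc w S
  have hSW : S * W = cfc (fun s => s * w s) S := by
    rw [cfc_mul (fun s => s) w S (by fun_prop) hw.continuousOn, cfc_id' ℝ S]
  have hcomm : Commute S W := cfc_commute_cfc (fun s => s) w S |> fun h => by
    rwa [cfc_id' ℝ S] at h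
  refine ⟨W, ?_, ?_, ?_, ?_, ?_, ?_⟩
  · rw [← ContinuousLinearMap.nonneg_iff_isPositive, hSW]
    exact cfc_nonneg fun s hs => mul_nonneg (spectrum_nonneg_of_nonneg hS0 hs)
      (inv_nonneg.2 (hr s).le)
  · refine (norm_mul_le _ _).trans (mul_le_of_le_one_right (norm_nonneg _) ?_)
    refine norm_cfc_le zero_le_one fun s _ => ?_
    rw [Real.norm_of_nonneg (inv_nonneg.2 (hr s).le)]
    exact inv_le_one_of_one_le₀ (Real.one_le_sqrt.2 (by nlinarith [mul_nonneg (sq_nonneg l) (sq_nonneg s)]))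
  · by_cases hl : l = 0
    · simp [hl]
    · rw [← le_div_iff₀' (abs_pos.2 hl), hSW]
      refine norm_cfc_le (by positivity) fun s _ => ?_
      rw [le_div_iff₀' (abs_pos.2 hl), Real.norm_eq_abs, abs_mul, abs_of_pos (inv_pos.2 (hr s)),
        ← mul_assoc, ← abs_mul, mul_inv_le_iff₀ (hr s), one_mul]
      refine Real.le_sqrt_of_sq_le ?_
      rw [sq_abs, mul_pow]
      linarith
  · rw [mul_assoc, ← mul_assoc W S W, ← hcomm.eq, mul_assoc, mul_assoc]
  · rw [hcomm.eq, mul_assoc, ← mul_assoc S W S, hcomm.eq, mul_assoc, mul_assoc]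
  · have h1 : W * W = cfc (fun s => w s * w s) S :=
      (cfc_mul w w S hw.continuousOn hw.continuousOn).symm
    have h2 : S * S = cfc (fun s : ℝ => s * s) S := by
      rw [cfc_mul (fun s => s) (fun s => s) S (by fun_prop) (by fun_prop), cfc_id' ℝ S]
    have h3 : ((l : ℂ) ^ 2) • (S * S * (W * W)) = (l ^ 2 : ℝ) • (S * S * (W * W)) := by
      rw [← Complex.ofReal_pow, Complex.coe_smul]
    have hc1 : ContinuousOn (fun s => w s * w s) (spectrum ℝ S) := (hw.mul hw).continuousOn
    have hc2 : ContinuousOn (fun s => s * s * (w s * w s)) (spectrum ℝ S) :=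
      ContinuousOn.mul (by fun_prop) hc1
    have hc3 : ContinuousOn (fun s => (l ^ 2) • (s * s * (w s * w s))) (spectrum ℝ S) :=
      continuousOn_const.mul hc2
    rw [h3, h2, h1, ← cfc_mul (fun s : ℝ => s * s) _ S (by fun_prop) hc1,
      ← cfc_smul (l ^ 2) (fun s => s * s * (w s * w s)) S hc2,
      ← cfc_add (a := S) _ _ hc1 hc3, ← cfc_const_one ℝ S]
    refine cfc_congr fun s _ => ?_
    have hws : w s * w s = (1 + l ^ 2 * s ^ 2)⁻¹ := by
      rw [hwdef]
      simp only
      rw [← mul_inv, Real.mul_self_sqrt (hd s).le]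
    simp only [hws, smul_eq_mul]
    have := (hd s).ne'
    field_simp

end InvSqrt

/-! ### Slice maps and the ideal in the algebraic tensor product -/

section TensorAlgebra

variable {B C : Type*} [Ring B] [Algebra ℂ B] [Ring C] [Algebra ℂ C]

/-- The slice map `a ⊗ b ↦ φ(b) a`. -/
def sliceRight (φ : C →ₗ[ℂ] ℂ) : B ⊗[ℂ] C →ₗ[ℂ] B :=
  TensorProduct.rid ℂ B ∘ₗ TensorProduct.map LinearMap.id φ

/-- The slice map `a ⊗ b ↦ φ(a) b`. -/
def sliceLeft (φ : B →ₗ[ℂ] ℂ) : B ⊗[ℂ] C →ₗ[ℂ] C :=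
  TensorProduct.lid ℂ C ∘ₗ TensorProduct.map φ LinearMap.id

@[simp]
theorem sliceRight_tmul (φ : C →ₗ[ℂ] ℂ) (a : B) (b : C) :
    sliceRight φ (a ⊗ₜ[ℂ] b) = φ b • a := by
  simp [sliceRight]

@[simp]
theorem sliceLeft_tmul (φ : B →ₗ[ℂ] ℂ) (a : B) (b : C) :
    sliceLeft φ (a ⊗ₜ[ℂ] b) = φ a • b := by
  simp [sliceLeft]

theorem sliceRight_mul_tmul_one (φ : C →ₗ[ℂ] ℂ) (z : B ⊗[ℂ] C) (a : B) :
    sliceRight φ (z * a ⊗ₜ[ℂ] 1) = sliceRight φ z * a := by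
  induction z with
  | zero => simp
  | tmul x y => simp
  | add x y hx hy => rw [add_mul, map_add, map_add, hx, hy, add_mul]

theorem sliceRight_tmul_one_mul (φ : C →ₗ[ℂ] ℂ) (z : B ⊗[ℂ] C) (a : B) :
    sliceRight φ (a ⊗ₜ[ℂ] 1 * z) = a * sliceRight φ z := by
  induction z with
  | zero => simp
  | tmul x y => simp
  | add x y hx hy => rw [mul_add, map_add, map_add, hx, hy, mul_add]

/-- Expand `z` along a basis of `C` with coefficients in `B`: applying `φ` to a coefficient gives
the corresponding coordinate of the slice, and `Φ` separates points. -/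
theorem eq_zero_of_sliceLeft_eq_zero {Φ : Set (B →ₗ[ℂ] ℂ)}
    (hΦ : ∀ a, (∀ φ ∈ Φ, φ a = 0) → a = 0) {z : B ⊗[ℂ] C} (hz : ∀ φ ∈ Φ, sliceLeft φ z = 0) :
    z = 0 := by
  classical
  let c := Module.Basis.ofVectorSpace ℂ C
  have key : ∀ (φ : B →ₗ[ℂ] ℂ) (i) (z : B ⊗[ℂ] C),
      φ (TensorProduct.equivFinsuppOfBasisRight c z i) = c.repr (sliceLeft φ z) i := by
    intro φ i z
    induction z with
    | zero => simp
    | tmul x y => simp [mul_comm]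
    | add x y hx hy => simp only [map_add, Finsupp.add_apply, hx, hy]
  apply (TensorProduct.equivFinsuppOfBasisRight c).injective
  rw [map_zero]
  ext i
  exact hΦ _ fun φ hφ => by rw [key, hz φ hφ, map_zero, Finsupp.zero_apply]

/-- The ideal `A ⊗ C` of `B ⊗ C`. -/
abbrev tensorIdeal (C : Type*) [Ring C] [Algebra ℂ C] (A : Submodule ℂ B) :
    Submodule ℂ (B ⊗[ℂ] C) :=
  LinearMap.range (TensorProduct.map A.subtype (LinearMap.id : C →ₗ[ℂ] C))

variable {A : Submodule ℂ B}

theorem tmul_mem_tensorIdeal {a : B} (ha : a ∈ A) (c : C) : a ⊗ₜ[ℂ] c ∈ tensorIdeal C A :=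
  ⟨(⟨a, ha⟩ : A) ⊗ₜ c, rfl⟩

theorem tensorIdeal_induction {p : B ⊗[ℂ] C → Prop} (h₀ : p 0)
    (ht : ∀ a ∈ A, ∀ c, p (a ⊗ₜ[ℂ] c)) (ha : ∀ x y, p x → p y → p (x + y)) {z : B ⊗[ℂ] C}
    (hz : z ∈ tensorIdeal C A) : p z := by
  obtain ⟨t, rfl⟩ := hz
  induction t with
  | zero => rwa [map_zero]
  | tmul x y => exact ht _ x.2 y
  | add x y hx hy => rw [map_add]; exact ha _ _ hx hy

theorem sliceRight_mem (φ : C →ₗ[ℂ] ℂ) {z : B ⊗[ℂ] C} (hz : z ∈ tensorIdeal C A) :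
    sliceRight φ z ∈ A :=
  tensorIdeal_induction (p := fun z => sliceRight φ z ∈ A) (by simp)
    (fun a ha c => by simpa using A.smul_mem _ ha)
    (fun x y hx hy => by rw [map_add]; exact add_mem hx hy) hz

theorem tensorIdeal_mul_mem (hA : ∀ a ∈ A, ∀ b : B, a * b ∈ A ∧ b * a ∈ A) {z : B ⊗[ℂ] C}
    (hz : z ∈ tensorIdeal C A) (w : B ⊗[ℂ] C) :
    z * w ∈ tensorIdeal C A ∧ w * z ∈ tensorIdeal C A := by
  refine tensorIdeal_induction
    (p := fun z => z * w ∈ tensorIdeal C A ∧ w * z ∈ tensorIdeal C A) ?_ ?_ ?_ hz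
  · rw [zero_mul, mul_zero]
    exact ⟨zero_mem _, zero_mem _⟩
  · intro a ha c
    induction w with
    | zero =>
      rw [zero_mul, mul_zero]
      exact ⟨zero_mem _, zero_mem _⟩
    | tmul b d =>
      rw [Algebra.TensorProduct.tmul_mul_tmul, Algebra.TensorProduct.tmul_mul_tmul]
      exact ⟨tmul_mem_tensorIdeal (hA a ha b).1 _, tmul_mem_tensorIdeal (hA a ha b).2 _⟩
    | add x y hx hy =>
      rw [mul_add, add_mul]
      exact ⟨add_mem hx.1 hy.1, add_mem hx.2 hy.2⟩
  · intro x y hx hy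
    rw [mul_add, add_mul]
    exact ⟨add_mem hx.1 hy.1, add_mem hx.2 hy.2⟩

/-- Slicing is linear over multiplication by `a ⊗ 1`, so with `φ 1 = 1` the slice of an identity of
the tensor ideal would be an identity of `A`. -/
theorem tensorIdeal_no_unit [Nontrivial C] (hA : ¬ ∃ e ∈ A, ∀ a ∈ A, e * a = a ∧ a * e = a) :
    ¬ ∃ e ∈ tensorIdeal C A, ∀ z ∈ tensorIdeal C A, e * z = z ∧ z * e = z := by
  rintro ⟨e, he, h⟩
  obtain ⟨φ, hφ⟩ : ∃ φ : C →ₗ[ℂ] ℂ, φ 1 = 1 := by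
    obtain ⟨φ, hφ⟩ := not_forall.1
      (mt (Module.forall_dual_apply_eq_zero_iff ℂ (1 : C)).1 one_ne_zero)
    exact ⟨(φ 1)⁻¹ • φ, by simp [inv_mul_cancel₀ hφ]⟩
  refine hA ⟨sliceRight φ e, sliceRight_mem φ he, fun a ha => ?_⟩
  obtain ⟨h₁, h₂⟩ := h _ (tmul_mem_tensorIdeal ha 1)
  rw [← sliceRight_mul_tmul_one, ← sliceRight_tmul_one_mul, h₁, h₂, sliceRight_tmul, hφ, one_smul]
  exact ⟨rfl, rfl⟩

end TensorAlgebra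

/-! ### Faithfulness of the tensor product representation -/

section TensorRep

variable {B H C K : Type*} [Ring B] [StarRing B] [Algebra ℂ B] [StarModule ℂ B]
  [NormedAddCommGroup H] [InnerProductSpace ℂ H] [CompleteSpace H]
  [Ring C] [StarRing C] [Algebra ℂ C] [StarModule ℂ C]
  [NormedAddCommGroup K] [InnerProductSpace ℂ K] [CompleteSpace K]

theorem star_mem_tensorIdeal {A : Submodule ℂ B} (hA : ∀ a ∈ A, star a ∈ A) {z : B ⊗[ℂ] C}
    (hz : z ∈ tensorIdeal C A) : star z ∈ tensorIdeal C A :=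
  tensorIdeal_induction (p := fun z => star z ∈ tensorIdeal C A)
    (by rw [star_zero]; exact zero_mem _)
    (fun a ha c => by
      rw [TensorProduct.star_tmul]
      exact tmul_mem_tensorIdeal (hA a ha) _)
    (fun x y hx hy => by rw [star_add]; exact add_mem hx hy) hz

theorem inner_tensorRep (π : B →⋆ₐ[ℂ] (H →L[ℂ] H)) (ρ : C →⋆ₐ[ℂ] (K →L[ℂ] K)) (z : B ⊗[ℂ] C)
    (x x' : H) (y y' : K) (φ : B →ₗ[ℂ] ℂ) (hφ : ∀ a, φ a = inner ℂ x' (π a x)) :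
    inner ℂ (toHilbertTensor H K (x' ⊗ₜ[ℂ] y'))
      (tensorRep π ρ z (toHilbertTensor H K (x ⊗ₜ[ℂ] y))) =
      inner ℂ y' (ρ (sliceLeft φ z) y) := by
  induction z with
  | zero => simp
  | tmul a b =>
    rw [tensorRep_tmul, tensorOp_coe, TensorProduct.map_tmul, inner_toHilbertTensor_tmul,
      sliceLeft_tmul, map_smul, hφ, smul_apply, inner_smul_right]
    rfl
  | add z w hz hw =>
    rw [map_add, map_add, map_add, add_apply, add_apply,
      inner_add_right, inner_add_right, hz, hw]

/-- The matrix coefficients `a ↦ ⟪x', π a x⟫` separate the points of `B`. Slicing an element of the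
kernel by one of them gives an element killed by `ρ`, hence zero. -/
theorem tensorRep_injective {π : B →⋆ₐ[ℂ] (H →L[ℂ] H)} {ρ : C →⋆ₐ[ℂ] (K →L[ℂ] K)}
    (hπ : Function.Injective π) (hρ : Function.Injective ρ) :
    Function.Injective (tensorRep π ρ) := by
  refine (injective_iff_map_eq_zero _).2 fun z hz => ?_
  let φ : H → H → B →ₗ[ℂ] ℂ := fun x x' =>
    ((innerSL ℂ x').comp (ContinuousLinearMap.apply ℂ H x)).toLinearMap ∘ₗ
      (π : B →ₐ[ℂ] (H →L[ℂ] H)).toLinearMap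
  have hφ : ∀ x x' a, φ x x' a = inner ℂ x' (π a x) := fun _ _ _ => rfl
  refine eq_zero_of_sliceLeft_eq_zero (Φ := {ψ | ∃ x x', ψ = φ x x'}) (fun a ha => ?_) ?_
  · rw [← map_eq_zero_iff π hπ]
    ext x
    refine ext_inner_left ℂ fun x' => ?_
    rw [← hφ, ha _ ⟨x, x', rfl⟩, zero_apply, inner_zero_right]
  · rintro _ ⟨x, x', rfl⟩
    rw [← map_eq_zero_iff ρ hρ]
    ext y
    refine ext_inner_left ℂ fun y' => ?_
    rw [← inner_tensorRep π ρ z x x' y y' (φ x x') (hφ x x'), hz]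
    simp

theorem commute_tensorOp_tensorRep {π : B →⋆ₐ[ℂ] (H →L[ℂ] H)} {ρ : C →⋆ₐ[ℂ] (K →L[ℂ] K)}
    {J : H →L[ℂ] H} (hJ : ∀ a, Commute J (π a)) (z : B ⊗[ℂ] C) :
    Commute (tensorOp J (1 : K →L[ℂ] K)) (tensorRep π ρ z) := by
  induction z with
  | zero => rw [map_zero]; exact Commute.zero_right _
  | tmul a b =>
    refine tensorOp_ext fun x y => ?_
    have h := DFunLike.congr_fun (hJ a).eq x
    simp only [mul_apply_eq_comp] at h
    simp [tensorRep_tmul, tensorOp_coe, h]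
  | add z w hz hw => rw [map_add]; exact hz.add_right hw

end TensorRep

section TensorOp

variable {H K : Type*} [NormedAddCommGroup H] [InnerProductSpace ℂ H]
  [NormedAddCommGroup K] [InnerProductSpace ℂ K]

theorem tensorOp_one_mul_one (a b : H →L[ℂ] H) :
    tensorOp a (1 : K →L[ℂ] K) * tensorOp b 1 = tensorOp (a * b) 1 :=
  tensorOp_ext fun x y => by simp [tensorOp_coe]

theorem tensorOp_one_one : tensorOp (1 : H →L[ℂ] H) (1 : K →L[ℂ] K) = 1 :=
  tensorOp_ext fun x y => by simp [tensorOp_coe]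

end TensorOp

/-! ### Compactness of decaying diagonal operators -/

section Compact

variable {H K : Type*} [NormedAddCommGroup H] [InnerProductSpace ℂ H] [CompleteSpace H]
  [NormedAddCommGroup K] [InnerProductSpace ℂ K] {ι : Type*} {e : HilbertBasis ι ℂ K}

/-- Truncating `A` to the finitely many summands where `‖R i‖` is not small leaves a finite sum of
compact operators and an error of small norm. The operator `b` need not be compact or diagonal,
since it only replaces `e i` by `b (e i)`. -/
theorem isCompactOperator_tensorOp_diagonal {a : H →L[ℂ] H} {b : K →L[ℂ] K} {R : ι → H →L[ℂ] H}
    (hR : ∀ i, IsCompactOperator (a ∘L R i)) (hfin : ∀ ε > 0, {i | ε < ‖R i‖}.Finite)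
    {A : HilbertTensor H K →L[ℂ] HilbertTensor H K}
    (hA : ∀ i z, coord (basisIncl H e) i (A z) = R i (coord (basisIncl H e) i z)) :
    IsCompactOperator (tensorOp a b ∘L A) := by
  classical
  have hV := isHilbertSum_basisIncl (H := H) e
  refine isClosed_setOfPred_isCompactOperator.closure_subset
    (Metric.mem_closure_iff.2 fun ε hε => ?_ :
      tensorOp a b ∘L A ∈ closure {f : HilbertTensor H K →L[ℂ] HilbertTensor H K |
        IsCompactOperator f})
  -- The added `1` keeps the denominator positive and makes the final estimate strict.
  set δ := ε / (‖tensorOp a b‖ + 1)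
  have hδ : 0 < δ := by positivity
  set s := (hfin δ hδ).toFinset with hs
  let A' : HilbertTensor H K →L[ℂ] HilbertTensor H K := ∑ i ∈ s,
    (basisIncl H e i).toContinuousLinearMap ∘L R i ∘L coord (basisIncl H e) i
  refine ⟨tensorOp a b ∘L A', ?_, ?_⟩
  · have h : tensorOp a b ∘L A' =
        ∑ i ∈ s, tmulRight H (b (e i)) ∘L (a ∘L R i) ∘L coord (basisIncl H e) i := by
      ext z
      simp only [A', ContinuousLinearMap.comp_apply, sum_apply, map_sum]
      refine Finset.sum_congr rfl fun i _ => ?_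
      exact tensorOp_coe a b _
    rw [h]
    exact (compactOperator (RingHom.id ℂ) (HilbertTensor H K) (HilbertTensor H K)).sum_mem
      fun i _ => ((hR i).comp_clm (coord (basisIncl H e) i)).clm_comp (tmulRight H (b (e i)))
  · have h : ‖A - A'‖ ≤ δ := by
      refine hV.norm_diagonal_le (R := fun i => if i ∈ s then 0 else R i) hδ.le (fun i => ?_) ?_
      · split_ifs with hi
        · simpa using hδ.le
        · simpa [hs] using hi
      · intro j z
        rw [sub_apply, map_sub, hA, sum_apply, map_sum]
        have h0 : ∀ i ∈ s, i ≠ j → coord (basisIncl H e) j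
            (((basisIncl H e i).toContinuousLinearMap ∘L R i ∘L coord (basisIncl H e) i) z) = 0 :=
          fun i _ hij => hV.coord_of_ne hij.symm _
        by_cases hj : j ∈ s
        · rw [Finset.sum_eq_single_of_mem j hj h0, if_pos hj]
          exact sub_eq_zero.2 (coord_self (V := basisIncl H e) j _).symm
        · rw [if_neg hj, Finset.sum_eq_zero fun i hi => h0 i hi (ne_of_mem_of_not_mem hi hj),
            sub_zero]
    rw [dist_eq_norm, ← ContinuousLinearMap.comp_sub]
    calc _ ≤ ‖tensorOp a b‖ * ‖A - A'‖ := ContinuousLinearMap.opNorm_comp_le _ _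
      _ ≤ ‖tensorOp a b‖ * δ := by gcongr
      _ < (‖tensorOp a b‖ + 1) * δ := by gcongr; exact lt_add_one _
      _ = ε := mul_div_cancel₀ _ (by positivity)

end Compact

/-! ### Bounded perturbations -/

section ShiftGraph

variable {H : Type*} [NormedAddCommGroup H] [InnerProductSpace ℂ H]

/-- The graph of `P + A`, where `G` is the graph of `P` and `A` is bounded. -/
def shiftGraph (G : Submodule ℂ (H × H)) (A : H →L[ℂ] H) : Submodule ℂ (H × H) :=
  G.comap ((LinearMap.fst ℂ H H).prod
    (LinearMap.snd ℂ H H - (A : H →ₗ[ℂ] H) ∘ₗ LinearMap.fst ℂ H H))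

theorem mem_shiftGraph {G : Submodule ℂ (H × H)} {A : H →L[ℂ] H} {x y : H} :
    (x, y) ∈ shiftGraph G A ↔ (x, y - A x) ∈ G := Iff.rfl

theorem add_mem_shiftGraph {G : Submodule ℂ (H × H)} {A : H →L[ℂ] H} {x y : H}
    (h : (x, y) ∈ G) : (x, y + A x) ∈ shiftGraph G A := by
  rwa [mem_shiftGraph, add_sub_cancel_right]

theorem isClosed_shiftGraph {G : Submodule ℂ (H × H)} (hG : IsClosed (G : Set (H × H)))
    (A : H →L[ℂ] H) : IsClosed (shiftGraph G A : Set (H × H)) :=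
  hG.preimage (f := fun p : H × H => (p.1, p.2 - A p.1)) (by fun_prop)

theorem LinearPMap.eq_zero_of_mem_shiftGraph {f : H →ₗ.[ℂ] H} {A : H →L[ℂ] H} {y : H}
    (h : (0, y) ∈ shiftGraph f.graph A) : y = 0 := by
  rw [mem_shiftGraph, A.map_zero, sub_zero] at h
  exact f.graph_fst_eq_zero_snd h rfl

theorem adjoint_shiftGraph [CompleteSpace H] (G : Submodule ℂ (H × H)) (A : H →L[ℂ] H) :
    (shiftGraph G A).adjoint = shiftGraph G.adjoint (ContinuousLinearMap.adjoint A) := by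
  ext ⟨x, y⟩
  simp only [mem_shiftGraph, Submodule.mem_adjoint_iff, sub_eq_zero, inner_sub_right,
    ContinuousLinearMap.adjoint_inner_right]
  constructor
  · intro h a b hab
    have := h a (b + A a) (by rwa [add_sub_cancel_right])
    rw [← this, inner_add_left, add_sub_cancel_right]
  · intro h a b hab
    have := h a _ hab
    rwa [inner_sub_left, sub_left_inj] at this

end ShiftGraph

/-! ### The symmetries `J` and `γ` on graphs -/

section KreinSymmetry

variable {H : Type*} [NormedAddCommGroup H] [InnerProductSpace ℂ H]

/-- `D† = -J D J` in terms of graphs. -/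
theorem eq_neg_conj_iff {D D' : H →ₗ.[ℂ] H} {J : H →L[ℂ] H} (hJ : J * J = 1) :
    D' = -(opComp (bddOp J) (opComp D (bddOp J))) ↔
      ∀ x y, (x, y) ∈ D'.graph ↔ (J x, -J y) ∈ D.graph := by
  have hJ' : ∀ x, J (J x) = x := fun x => DFunLike.congr_fun hJ x
  have key : ∀ x y, (x, y) ∈ (-(opComp (bddOp J) (opComp D (bddOp J)))).graph ↔
      (J x, -J y) ∈ D.graph := by
    intro x y
    simp only [mem_graph_neg, mem_graph_opComp, mem_graph_bddOp]
    constructor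
    · rintro ⟨v, ⟨u, rfl, huv⟩, hv⟩
      rwa [← map_neg, hv, hJ']
    · intro h
      exact ⟨_, ⟨_, rfl, h⟩, by rw [map_neg, hJ']⟩
  constructor
  · rintro rfl
    exact key
  · intro h
    refine LinearPMap.eq_of_eq_graph ?_
    ext ⟨x, y⟩
    rw [h, key]

theorem neg_mem_graph_of_anticomm {D : H →ₗ.[ℂ] H} {γ : H →L[ℂ] H}
    (h : opComp (bddOp γ) D = -(opComp D (bddOp γ))) {x y : H} (hxy : (x, y) ∈ D.graph) :
    (γ x, -γ y) ∈ D.graph := by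
  have h' : (x, γ y) ∈ (opComp (bddOp γ) D).graph :=
    mem_graph_opComp.2 ⟨y, hxy, mem_graph_bddOp.2 rfl⟩
  rw [h, mem_graph_neg, mem_graph_opComp] at h'
  obtain ⟨u, hu, hu'⟩ := h'
  rwa [mem_graph_bddOp.1 hu] at hu'

theorem mem_graph_of_comm {T : H →ₗ.[ℂ] H} {γ : H →L[ℂ] H}
    (h : opComp (bddOp γ) T = opComp T (bddOp γ)) {x y : H} (hxy : (x, y) ∈ T.graph) :
    (γ x, γ y) ∈ T.graph := by
  have h' : (x, γ y) ∈ (opComp (bddOp γ) T).graph :=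
    mem_graph_opComp.2 ⟨y, hxy, mem_graph_bddOp.2 rfl⟩
  rw [h, mem_graph_opComp] at h'
  obtain ⟨u, hu, hu'⟩ := h'
  rwa [mem_graph_bddOp.1 hu] at hu'

theorem mem_graph_half_anticomm {D D' : H →ₗ.[ℂ] H} {x w : H} :
    (x, w) ∈ ((1 / 2 : ℂ) • (opComp D D' + opComp D' D)).graph ↔
      ∃ u p v q, (x, u) ∈ D'.graph ∧ (u, p) ∈ D.graph ∧ (x, v) ∈ D.graph ∧ (v, q) ∈ D'.graph ∧
        w = (1 / 2 : ℂ) • (p + q) := by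
  simp only [mem_graph_smul, mem_graph_add, mem_graph_opComp]
  constructor
  · rintro ⟨_, ⟨p, q, ⟨u, h₁, h₂⟩, ⟨v, h₃, h₄⟩, rfl⟩, rfl⟩
    exact ⟨u, p, v, q, h₁, h₂, h₃, h₄, rfl⟩
  · rintro ⟨u, p, v, q, h₁, h₂, h₃, h₄, rfl⟩
    exact ⟨_, ⟨p, q, ⟨u, h₁, h₂⟩, ⟨v, h₃, h₄⟩, rfl⟩, rfl⟩

end KreinSymmetry

/-! ### Closed tensor operators as direct sums -/

section ClosedSum

variable {H K : Type*} [NormedAddCommGroup H] [InnerProductSpace ℂ H] [CompleteSpace H]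
  [NormedAddCommGroup K] [InnerProductSpace ℂ K] {ι : Type*} {e : HilbertBasis ι ℂ K}

theorem graph_closure_algTensor_one {T : H →ₗ.[ℂ] H} (hT : T.IsClosed) :
    (algTensor T (bddOp (1 : K →L[ℂ] K))).closure.graph =
      sumGraph (basisIncl H e) fun _ => T.graph := by
  refine (isHilbertSum_basisIncl e).closure_graph_eq_sumGraph (fun _ => hT)
    (fun _ y hy => T.graph_fst_eq_zero_snd hy rfl) (graph_algTensor_le ?_) fun i x y hxy =>
      Submodule.le_topologicalClosure _ ?_
  · intro x x' y y' hx hy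
    rw [mem_graph_bddOp.1 hy, mem_sumGraph]
    intro i
    rw [coord_basisIncl_tmul, coord_basisIncl_tmul]
    exact T.graph.smul_mem _ hx
  · exact tmul_mem_graph_algTensor hxy (mem_graph_bddOp.2 rfl)

/-- For `y` in the domain of `Q`, self-adjointness gives `⟪e i, Q y⟫ = l i * ⟪e i, y⟫`, so the
`i`-th coordinate is acted on by `D + l i • γ`. Conversely `Dom D ⊗ e i` already lies in the
algebraic domain. -/
theorem graph_closure_algTensor_add [CompleteSpace K] {D : H →ₗ.[ℂ] H} (hD : D.IsClosed)
    {γ : H →L[ℂ] H} {Q : K →ₗ.[ℂ] K} (hQ : IsSelfAdjoint Q) {l : ι → ℝ}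
    (hl : ∀ i, (e i, (l i : ℂ) • e i) ∈ Q.graph) :
    (algTensor D (bddOp 1) + algTensor (bddOp γ) Q).closure.graph =
      sumGraph (basisIncl H e) fun i => shiftGraph D.graph ((l i : ℂ) • γ) := by
  refine (isHilbertSum_basisIncl e).closure_graph_eq_sumGraph
    (fun i => isClosed_shiftGraph hD _) (fun _ y hy => D.eq_zero_of_mem_shiftGraph hy) ?_
    fun i x y hxy => Submodule.le_topologicalClosure _ ?_
  · rintro ⟨z, w⟩ hzw
    obtain ⟨a, b, ha, hb, rfl⟩ := mem_graph_add.1 hzw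
    have ha' := graph_algTensor_le (G := sumGraph (basisIncl H e) fun _ => D.graph)
      (fun x x' y y' hx hy => by
        rw [mem_graph_bddOp.1 hy, mem_sumGraph]
        intro i
        rw [coord_basisIncl_tmul, coord_basisIncl_tmul]
        exact D.graph.smul_mem _ hx) ha
    have hb' := graph_algTensor_le
      (G := sumGraph (basisIncl H e) fun i => (bddOp ((l i : ℂ) • γ)).graph)
      (fun x x' y y' hx hy => by
        rw [mem_sumGraph]
        intro i
        rw [mem_graph_bddOp.1 hx, coord_basisIncl_tmul, coord_basisIncl_tmul, mem_graph_bddOp,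
          ← hQ.inner_graph (hl i) hy, inner_smul_left, Complex.conj_ofReal, map_smul, smul_apply,
          smul_smul, mul_comm]) hb
    refine mem_sumGraph.2 fun i => ?_
    rw [map_add, mem_graph_bddOp.1 (mem_sumGraph.1 hb' i)]
    exact add_mem_shiftGraph (mem_sumGraph.1 ha' i)
  · refine mem_graph_add.2 ⟨_, _, tmul_mem_graph_algTensor (mem_shiftGraph.1 hxy)
      (mem_graph_bddOp.2 rfl), tmul_mem_graph_algTensor (mem_graph_bddOp.2 rfl) (hl i), ?_⟩
    rw [← map_add, basisIncl_apply, _root_.one_apply_eq_self, TensorProduct.tmul_smul,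
      TensorProduct.smul_tmul', ← TensorProduct.add_tmul, smul_apply, sub_add_cancel]

end ClosedSum

/-! ### Bounded commutators with the algebra -/

section BoundedCommutator

/-- The pairs `(z, w)` with `(A z, A w + C z) ∈ G`. If `G` is the graph of `D` and it is contained
in `commutatorGraph G A C`, then `[D, A]` extends to `C`. -/
def commutatorGraph {E : Type*} [NormedAddCommGroup E] [InnerProductSpace ℂ E]
    (G : Submodule ℂ (E × E)) (A C : E →L[ℂ] E) : Submodule ℂ (E × E) :=
  G.comap (((A : E →ₗ[ℂ] E) ∘ₗ LinearMap.fst ℂ E E).prod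
    ((A : E →ₗ[ℂ] E) ∘ₗ LinearMap.snd ℂ E E + (C : E →ₗ[ℂ] E) ∘ₗ LinearMap.fst ℂ E E))

theorem mem_commutatorGraph {E : Type*} [NormedAddCommGroup E] [InnerProductSpace ℂ E]
    {G : Submodule ℂ (E × E)} {A C : E →L[ℂ] E} {z w : E} :
    (z, w) ∈ commutatorGraph G A C ↔ (A z, A w + C z) ∈ G := Iff.rfl

variable {H K : Type*} [NormedAddCommGroup H] [InnerProductSpace ℂ H]
  [NormedAddCommGroup K] [InnerProductSpace ℂ K]

theorem exists_commutator_algTensor_add {D : H →ₗ.[ℂ] H} {γ : H →L[ℂ] H} {Q : K →ₗ.[ℂ] K}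
    {a : H →L[ℂ] H} (ha : HasBoundedCommutator D a) (haγ : Commute γ a) {b : K →L[ℂ] K}
    (hb : HasBoundedCommutator Q b) :
    ∃ C : HilbertTensor H K →L[ℂ] HilbertTensor H K,
      ∀ z w, (z, w) ∈ (algTensor D (bddOp 1) + algTensor (bddOp γ) Q).graph →
        (tensorOp a b z, tensorOp a b w + C z) ∈
          (algTensor D (bddOp 1) + algTensor (bddOp γ) Q).graph := by
  obtain ⟨C₁, hC₁⟩ := hasBoundedCommutator_iff.1 ha
  obtain ⟨C₂, hC₂⟩ := hasBoundedCommutator_iff.1 hb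
  -- This is `[D, a] ⊗ b + γ a ⊗ [Q, b]`; the second term uses `γ a = a γ`.
  refine ⟨tensorOp C₁ b + tensorOp (γ * a) C₂, fun z w hzw => ?_⟩
  obtain ⟨u, v, hu, hv, rfl⟩ := mem_graph_add.1 hzw
  have hu' := graph_algTensor_le (G := commutatorGraph (algTensor D (bddOp 1)).graph
      (tensorOp a b) (tensorOp C₁ b))
    (fun x x' y y' hx hy => by
      rw [mem_graph_bddOp.1 hy, mem_commutatorGraph, tensorOp_coe, tensorOp_coe, tensorOp_coe,
        ← map_add]
      convert! tmul_mem_graph_algTensor (hC₁ x x' hx) (mem_graph_bddOp.2 rfl) using 2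
      simp [TensorProduct.add_tmul]) hu
  have hv' := graph_algTensor_le (G := commutatorGraph (algTensor (bddOp γ) Q).graph
      (tensorOp a b) (tensorOp (γ * a) C₂))
    (fun x x' y y' hx hy => by
      rw [mem_graph_bddOp.1 hx, mem_commutatorGraph, tensorOp_coe, tensorOp_coe, tensorOp_coe,
        ← map_add]
      convert! tmul_mem_graph_algTensor (mem_graph_bddOp.2 rfl) (hC₂ y y' hy) using 2
      have := DFunLike.congr_fun haγ.eq x
      simp only [mul_apply_eq_comp] at this
      simp [TensorProduct.tmul_add, this]) hv
  refine mem_graph_add.2 ⟨_, _, mem_commutatorGraph.1 hu', mem_commutatorGraph.1 hv', ?_⟩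
  rw [map_add, add_apply]
  abel

/-- The map `(z, w) ↦ (A z, A w + C z)` is continuous, so it preserves the closure of any graph that
it preserves. -/
theorem hasBoundedCommutator_closure {P : H →ₗ.[ℂ] H} (hP : P.closure.IsClosed) {A C : H →L[ℂ] H}
    (h : ∀ z w, (z, w) ∈ P.graph → (A z, A w + C z) ∈ P.graph) :
    HasBoundedCommutator P.closure A := by
  refine hasBoundedCommutator_iff.2 ⟨C, fun x y hxy => ?_⟩
  rw [LinearPMap.closure_graph_eq_of_isClosed hP] at hxy ⊢
  exact map_mem_closure (f := fun p : H × H => (A p.1, A p.2 + C p.1)) (by fun_prop) hxy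
    fun p hp => h p.1 p.2 hp

theorem HasBoundedCommutator.add {D : H →ₗ.[ℂ] H} {a b : H →L[ℂ] H}
    (ha : HasBoundedCommutator D a) (hb : HasBoundedCommutator D b) :
    HasBoundedCommutator D (a + b) := by
  obtain ⟨C₁, hC₁⟩ := hasBoundedCommutator_iff.1 ha
  obtain ⟨C₂, hC₂⟩ := hasBoundedCommutator_iff.1 hb
  refine hasBoundedCommutator_iff.2 ⟨C₁ + C₂, fun x y hxy => ?_⟩
  convert! D.graph.add_mem (hC₁ x y hxy) (hC₂ x y hxy) using 1
  simp only [add_apply, Prod.mk_add_mk, Prod.mk.injEq, true_and]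
  abel

theorem HasBoundedCommutator.zero (D : H →ₗ.[ℂ] H) : HasBoundedCommutator D 0 :=
  hasBoundedCommutator_iff.2 ⟨0, fun x y _ => by simp⟩

end BoundedCommutator

/-! ### Direct sums of copies of a self-adjoint operator -/

section TimeOperator

variable {H K : Type*} [NormedAddCommGroup H] [InnerProductSpace ℂ H] [CompleteSpace H]
  [NormedAddCommGroup K] [InnerProductSpace ℂ K] [CompleteSpace K]

/-- The issue is whether the intermediate vectors `y i = T z_i` assemble to an element of `E`. By
self-adjointness `‖y i‖² = ⟪z_i, T² z_i⟫ = ⟪z_i, w_i⟫`, which is summable. -/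
theorem mem_graph_comp_iff_coord {ι E : Type*} [NormedAddCommGroup E]
    [InnerProductSpace ℂ E] [CompleteSpace E] {V : ι → H →ₗᵢ[ℂ] E}
    (hV : IsHilbertSum ℂ (fun _ => H) V) {T : H →ₗ.[ℂ] H} (hT : IsSelfAdjoint T)
    {T' : E →ₗ.[ℂ] E} (hT' : T'.graph = sumGraph V fun _ => T.graph) {z w : E} :
    (z, w) ∈ (opComp T' T').graph ↔ ∀ i, (coord V i z, coord V i w) ∈ (opComp T T).graph := by
  simp only [mem_graph_opComp]
  constructor
  · rintro ⟨v, hv, hv'⟩ i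
    rw [hT', mem_sumGraph] at hv hv'
    exact ⟨_, hv i, hv' i⟩
  · intro h
    choose y hy hy' using h
    have hs : Summable fun i => ‖y i‖ ^ 2 := by
      refine (Complex.hasSum_re (hV.hasSum_inner_coord z w)).summable.congr fun i => ?_
      rw [← hT.inner_graph (hy i) (hy' i), inner_self_eq_norm_sq_to_K]
      exact_mod_cast rfl
    obtain ⟨v, hv⟩ := hV.exists_coord_eq hs
    refine ⟨v, ?_, ?_⟩ <;> rw [hT', mem_sumGraph] <;> intro i <;> rw [hv]
    exacts [hy i, hy' i]

theorem dense_domain_of_graph_eq_sumGraph {ι E : Type*} [NormedAddCommGroup E]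
    [InnerProductSpace ℂ E] [CompleteSpace E] {V : ι → H →ₗᵢ[ℂ] E}
    (hV : IsHilbertSum ℂ (fun _ => H) V) {P : E →ₗ.[ℂ] E} {G : ι → Submodule ℂ (H × H)}
    (hP : P.graph = sumGraph V G) {U : Set H} (hU : Dense U)
    (h : ∀ i, ∀ x ∈ U, ∃ y, (x, y) ∈ G i) : Dense (P.domain : Set E) :=
  hV.dense_of_map_mem (U := fun _ => U) (fun _ => hU) fun i x hx => by
    obtain ⟨y, hy⟩ := h i x hx
    refine LinearPMap.mem_domain_iff.2 ⟨V i y, ?_⟩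
    rw [hP]
    exact hV.map_mem_sumGraph hy

theorem isSelfAdjoint_of_graph_eq_sumGraph {ι E : Type*} [NormedAddCommGroup E]
    [InnerProductSpace ℂ E] [CompleteSpace E] {V : ι → H →ₗᵢ[ℂ] E}
    (hV : IsHilbertSum ℂ (fun _ => H) V) {T : H →ₗ.[ℂ] H} (hT : IsSelfAdjoint T)
    {T' : E →ₗ.[ℂ] E} (hT' : T'.graph = sumGraph V fun _ => T.graph) : IsSelfAdjoint T' := by
  refine LinearPMap.eq_of_eq_graph ?_
  have hd : Dense (T'.domain : Set E) := dense_domain_of_graph_eq_sumGraph hV hT' hT.dense_domain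
    fun _ x hx => LinearPMap.mem_domain_iff.1 hx
  change T'.adjoint.graph = T'.graph
  rw [LinearPMap.adjoint_graph_eq_graph_adjoint hd, hT', hV.adjoint_sumGraph,
    ← LinearPMap.adjoint_graph_eq_graph_adjoint hT.dense_domain, LinearPMap.isSelfAdjoint_def.1 hT]

theorem isInvSqrtOneAdd_tensorOp {ι : Type*} (e : HilbertBasis ι ℂ K) {T : H →ₗ.[ℂ] H}
    (hT : IsSelfAdjoint T) {S : H →L[ℂ] H} (hS : IsInvSqrtOneAdd (opComp T T) S)
    {T' : HilbertTensor H K →ₗ.[ℂ] HilbertTensor H K}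
    (hT' : T'.graph = sumGraph (basisIncl H e) fun _ => T.graph) :
    IsInvSqrtOneAdd (opComp T' T') (tensorOp S 1) := by
  obtain ⟨hS₀, hS₁, hS₂⟩ := isInvSqrtOneAdd_iff.1 hS
  have hV := isHilbertSum_basisIncl (H := H) e
  have hc := coord_basisIncl_tensorOp_one (H := H) e
  refine isInvSqrtOneAdd_iff.2 ⟨hV.isPositive_of_diagonal (fun _ => hS₀) fun i z => hc i S z, ?_, ?_⟩
  · intro z
    rw [mem_graph_comp_iff_coord hV hT hT']
    intro i
    rw [map_sub, hc, hc]
    exact hS₁ _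
  · intro z w hzw
    rw [mem_graph_comp_iff_coord hV hT hT'] at hzw
    refine hV.ext_coord fun i => ?_
    rw [hc, hc, map_add]
    exact hS₂ _ _ (hzw i)

end TimeOperator

/-! ### The operator `⟨D⟩²` of the sum and its inverse square root -/

section Angle

variable {H : Type*} [NormedAddCommGroup H] [InnerProductSpace ℂ H] [CompleteSpace H]

/-- The uniform bound by `‖S‖` lets the blocks form a bounded operator, while `|l i| * ‖S ∘L W i‖ ≤
1` supplies the decay needed for compactness. The factor `S` stands on the left so that compactness
of `a S` passes to `a S (W i)`. -/
theorem isInvSqrtOneAdd_sum {ι E : Type*} [NormedAddCommGroup E]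
    [InnerProductSpace ℂ E] [CompleteSpace E] {V : ι → H →ₗᵢ[ℂ] E}
    (hV : IsHilbertSum ℂ (fun _ => H) V) {L : H →ₗ.[ℂ] H} {S : H →L[ℂ] H}
    (hS : IsInvSqrtOneAdd L S) (l : ι → ℝ) :
    ∃ (W : ι → H →L[ℂ] H) (R : E →L[ℂ] E),
      (∀ i z, coord V i (R z) = (S ∘L W i) (coord V i z)) ∧ (∀ i, |l i| * ‖S ∘L W i‖ ≤ 1) ∧
      ∀ L' : E →ₗ.[ℂ] E,
        L'.graph = sumGraph V (fun i => shiftGraph L.graph (((l i : ℂ) ^ 2) • 1)) →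
          IsInvSqrtOneAdd L' R := by
  obtain ⟨hS₀, hS₁, hS₂⟩ := isInvSqrtOneAdd_iff.1 hS
  choose W hW₀ hWn hWl hW₁ hW₂ hW₃ using fun i => hS₀.exists_invSqrt_shift (l i)
  obtain ⟨R, hR⟩ := hV.exists_diagonal (norm_nonneg S) hWn
  refine ⟨W, R, hR, hWl, fun L' hL' => isInvSqrtOneAdd_iff.2
    ⟨hV.isPositive_of_diagonal hW₀ hR, fun z => ?_, fun z w hzw => ?_⟩⟩
  · rw [hL', mem_sumGraph]
    intro i
    rw [mem_shiftGraph, map_sub, hR, hR]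
    set x := coord V i z
    have h₁ : (S * W i) ((S * W i) x) = S (S ((W i) (W i x))) := DFunLike.congr_fun (hW₁ i) x
    have h₃ : (W i) (W i x) + ((l i : ℂ) ^ 2) • S (S ((W i) (W i x))) = x :=
      DFunLike.congr_fun (hW₃ i) x
    rw [h₁]
    convert! hS₁ ((W i) (W i x)) using 2
    rw [smul_apply, one_apply_eq_self, sub_right_comm, ← eq_sub_of_add_eq h₃]
  · rw [hL', mem_sumGraph] at hzw
    refine hV.ext_coord fun i => ?_
    have h := hS₂ _ _ (mem_shiftGraph.1 (hzw i))
    rw [hR, hR, map_add]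
    set x := coord V i z
    set y := coord V i w
    rw [smul_apply, one_apply_eq_self] at h
    have h₂ : ∀ u, (S * W i) ((S * W i) u) = W i (W i (S (S u))) := fun u =>
      DFunLike.congr_fun (hW₂ i) u
    have h₃ : (W i) (W i x) + ((l i : ℂ) ^ 2) • S (S ((W i) (W i x))) = x :=
      DFunLike.congr_fun (hW₃ i) x
    have h₄ : W i (W i (S (S x))) = S (S (W i (W i x))) :=
      DFunLike.congr_fun ((hW₂ i).symm.trans (hW₁ i)) x
    have h₅ : x + y = (x + (y - (l i : ℂ) ^ 2 • x)) + (l i : ℂ) ^ 2 • x := by abel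
    rw [h₂, h₅, map_add, map_add, map_add, map_add, h, map_smul, map_smul, map_smul, map_smul, h₄,
      h₃]

theorem angleSq_graph_eq_sumGraph {ι E : Type*} [NormedAddCommGroup E]
    [InnerProductSpace ℂ E] [CompleteSpace E] {V : ι → H →ₗᵢ[ℂ] E}
    (hV : IsHilbertSum ℂ (fun _ => H) V) {D : H →ₗ.[ℂ] H} {γ : H →L[ℂ] H} {l : ι → ℝ}
    (hγ : ∀ x, γ (γ x) = x) (hD : ∀ x y, (x, y) ∈ D.graph → (γ x, -γ y) ∈ D.graph)
    (hD' : ∀ x y, (x, y) ∈ D.adjoint.graph → (γ x, -γ y) ∈ D.adjoint.graph)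
    (hcl : (angleSq D).IsClosed) {P : E →ₗ.[ℂ] E}
    (hP : P.graph = sumGraph V fun i => shiftGraph D.graph ((l i : ℂ) • γ))
    (hP' : P.adjoint.graph = sumGraph V fun i => shiftGraph D.adjoint.graph ((l i : ℂ) • γ)) :
    (angleSq P).graph = sumGraph V fun i => shiftGraph (angleSq D).graph (((l i : ℂ) ^ 2) • 1) := by
  refine hV.closure_graph_eq_sumGraph (fun i => isClosed_shiftGraph hcl _)
    (fun i y hy => (angleSq D).eq_zero_of_mem_shiftGraph hy) ?_ ?_
  · rintro ⟨z, w⟩ hzw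
    obtain ⟨u, p, v, q, hu, hp, hv, hq, rfl⟩ := mem_graph_half_anticomm.1 hzw
    rw [hP', mem_sumGraph] at hu hq
    rw [hP, mem_sumGraph] at hp hv
    refine mem_sumGraph.2 fun i => ?_
    replace hu := mem_shiftGraph.1 (hu i)
    replace hp := mem_shiftGraph.1 (hp i)
    replace hv := mem_shiftGraph.1 (hv i)
    replace hq := mem_shiftGraph.1 (hq i)
    rw [mem_shiftGraph, map_smul, map_add]
    generalize coord V i z = x at *
    generalize coord V i u = u at *
    generalize coord V i p = p at *
    generalize coord V i v = v at *
    generalize coord V i q = q at *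
    -- As `γ` preserves both domains, the terms in `γ` can be removed from `D D*` and `D* D`
    -- separately. What they leave, `∓ l i • γ (u - v)`, cancels in the sum.
    refine LinearPMap.le_graph_of_le (LinearPMap.le_closure _) (mem_graph_half_anticomm.2
      ⟨_, _, _, _, hu, D.graph.sub_mem hp (D.graph.smul_mem (l i : ℂ) (hD _ _ hv)), hv,
        D.adjoint.graph.sub_mem hq (D.adjoint.graph.smul_mem (l i : ℂ) (hD' _ _ hu)), ?_⟩)
    simp only [smul_apply, one_apply_eq_self, map_sub, map_smul, hγ, Prod.smul_snd]
    module
  · intro i x y hxy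
    have hmem : (x, y - (((l i : ℂ) ^ 2) • (1 : H →L[ℂ] H)) x) ∈ (angleSq D).graph := hxy
    rw [angleSq, LinearPMap.closure_graph_eq_of_isClosed hcl] at hmem
    have := map_mem_closure (f := fun p : H × H => (V i p.1, V i (p.2 + ((l i : ℂ) ^ 2) • p.1)))
      (((V i).continuous.comp continuous_fst).prodMk ((V i).continuous.comp (by fun_prop))) hmem
      (t := ((1 / 2 : ℂ) • (opComp P P.adjoint + opComp P.adjoint P)).graph) ?_
    · simp only [smul_apply, one_apply_eq_self, sub_add_cancel] at this
      exact this
    · rintro ⟨x, y⟩ hxy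
      obtain ⟨u, p, v, q, hu, hp, hv, hq, rfl⟩ := mem_graph_half_anticomm.1 hxy
      have mem : ∀ a b, (a, b) ∈ D.graph → (V i a, V i (b + (l i : ℂ) • γ a)) ∈ P.graph :=
        fun a b hab => hP ▸ hV.map_mem_sumGraph (add_mem_shiftGraph hab)
      have mem' : ∀ a b, (a, b) ∈ D.adjoint.graph →
          (V i a, V i (b + (l i : ℂ) • γ a)) ∈ P.adjoint.graph :=
        fun a b hab => hP' ▸ hV.map_mem_sumGraph (add_mem_shiftGraph hab)
      refine mem_graph_half_anticomm.2 ⟨_, _, _, _, mem' _ _ hu,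
        mem _ _ (D.graph.add_mem hp (D.graph.smul_mem (l i : ℂ) (hD _ _ hv))), mem _ _ hv,
        mem' _ _ (D.adjoint.graph.add_mem hq (D.adjoint.graph.smul_mem (l i : ℂ) (hD' _ _ hu))), ?_⟩
      rw [← map_add, ← map_smul]
      congr 1
      simp only [map_add, map_smul, hγ, Prod.smul_snd]
      module

end Angle

/-! ### Consequences of the axioms for a single triple -/

namespace LorentzianData.IsLorentzianSpectralTriple

variable {B H : Type*} [Ring B] [StarRing B] [Algebra ℂ B]
  [NormedAddCommGroup H] [InnerProductSpace ℂ H] [CompleteSpace H] {X : LorentzianData B H}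

theorem mem_graph_adjoint (hX : X.IsLorentzianSpectralTriple) (x y : H) :
    (x, y) ∈ X.D.adjoint.graph ↔ (X.J x, -X.J y) ∈ X.D.graph :=
  (eq_neg_conj_iff hX.J_sq).1 hX.D_adjoint x y

theorem J_apply_J (hX : X.IsLorentzianSpectralTriple) (x : H) : X.J (X.J x) = x :=
  DFunLike.congr_fun hX.J_sq x

/-- Closedness is not an axiom: it follows from `D = -J D* J`, because adjoints are closed and `J`
is bounded. -/
theorem isClosed_D (hX : X.IsLorentzianSpectralTriple) : X.D.IsClosed := by
  have h : (X.D.graph : Set (H × H)) =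
      (fun p : H × H => (X.J p.1, -X.J p.2)) ⁻¹' X.D.adjoint.graph := by
    ext ⟨x, y⟩
    rw [Set.mem_preimage, SetLike.mem_coe, SetLike.mem_coe, hX.mem_graph_adjoint, map_neg, neg_neg,
      hX.J_apply_J, hX.J_apply_J]
  rw [LinearPMap.IsClosed, h]
  exact (LinearPMap.adjoint_isClosed hX.dense_domain).preimage (by fun_prop)

theorem anticomm_adjoint (hX : X.IsLorentzianSpectralTriple) {γ : H →L[ℂ] H} (hγ : X.IsGrading γ)
    {x y : H} (hxy : (x, y) ∈ X.D.adjoint.graph) : (γ x, -γ y) ∈ X.D.adjoint.graph := by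
  have hJ : ∀ x, γ (X.J x) = -X.J (γ x) := fun x => DFunLike.congr_fun hγ.anticomm_J x
  rw [hX.mem_graph_adjoint] at hxy ⊢
  have h := X.D.graph.neg_mem (neg_mem_graph_of_anticomm hγ.anticomm_D hxy)
  simpa [hJ] using h

end LorentzianData.IsLorentzianSpectralTriple

/-! ### The axioms for the product -/

section Product

variable {B H C K : Type*} [Ring B] [StarRing B] [Algebra ℂ B] [StarModule ℂ B]
  [NormedAddCommGroup H] [InnerProductSpace ℂ H] [CompleteSpace H]
  [Ring C] [StarRing C] [Algebra ℂ C] [StarModule ℂ C]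
  [NormedAddCommGroup K] [InnerProductSpace ℂ K] [CompleteSpace K]
  {M : LorentzianData B H} {γ : H →L[ℂ] H} {F : RiemannianData C K}
  {ι : Type*} {e : HilbertBasis ι ℂ K} {l : ι → ℝ}

theorem LorentzianData.graph_prod_D (hM : M.IsLorentzianSpectralTriple)
    (hF : F.IsCompactSpectralTriple) (hl : ∀ i, (e i, (l i : ℂ) • e i) ∈ F.D.graph) :
    (M.prod γ F).D.graph =
      sumGraph (basisIncl H e) fun i => shiftGraph M.D.graph ((l i : ℂ) • γ) :=
  graph_closure_algTensor_add hM.isClosed_D hF.selfAdjoint hl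

theorem LorentzianData.dense_prod_D (hM : M.IsLorentzianSpectralTriple)
    (hF : F.IsCompactSpectralTriple) (hl : ∀ i, (e i, (l i : ℂ) • e i) ∈ F.D.graph) :
    Dense ((M.prod γ F).D.domain : Set (HilbertTensor H K)) :=
  dense_domain_of_graph_eq_sumGraph (isHilbertSum_basisIncl e) (graph_prod_D hM hF hl)
    hM.dense_domain fun _ x hx => by
      obtain ⟨y, hy⟩ := LinearPMap.mem_domain_iff.1 hx
      exact ⟨_, add_mem_shiftGraph hy⟩

theorem LorentzianData.graph_prod_D_adjoint (hM : M.IsLorentzianSpectralTriple)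
    (hγ : M.IsGrading γ) (hF : F.IsCompactSpectralTriple)
    (hl : ∀ i, (e i, (l i : ℂ) • e i) ∈ F.D.graph) :
    (M.prod γ F).D.adjoint.graph =
      sumGraph (basisIncl H e) fun i => shiftGraph M.D.adjoint.graph ((l i : ℂ) • γ) := by
  rw [LinearPMap.adjoint_graph_eq_graph_adjoint (dense_prod_D hM hF hl), graph_prod_D hM hF hl,
    (isHilbertSum_basisIncl e).adjoint_sumGraph]
  congr 1
  ext1 i
  rw [adjoint_shiftGraph, LinearPMap.adjoint_graph_eq_graph_adjoint hM.dense_domain, map_smulₛₗ,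
    hγ.adjoint_eq, Complex.conj_ofReal]

/-- On each summand this is `D* + l i • γ = -J (D + l i • γ) J`, where `-J γ J = γ J² = γ`. -/
theorem LorentzianData.prod_D_adjoint (hM : M.IsLorentzianSpectralTriple)
    (hγ : M.IsGrading γ) (hF : F.IsCompactSpectralTriple)
    (hl : ∀ i, (e i, (l i : ℂ) • e i) ∈ F.D.graph) :
    (M.prod γ F).D.adjoint = -(opComp (bddOp (M.prod γ F).J)
      (opComp (M.prod γ F).D (bddOp (M.prod γ F).J))) := by
  have hJ : ∀ x, γ (M.J x) = -M.J (γ x) := fun x => DFunLike.congr_fun hγ.anticomm_J x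
  have hJ2 : (M.prod γ F).J * (M.prod γ F).J = 1 := by
    change tensorOp M.J 1 * tensorOp M.J 1 = 1
    rw [tensorOp_one_mul_one, hM.J_sq, tensorOp_one_one]
  refine (eq_neg_conj_iff hJ2).2 fun z w => ?_
  rw [graph_prod_D hM hF hl, graph_prod_D_adjoint hM hγ hF hl, mem_sumGraph, mem_sumGraph]
  refine forall_congr' fun i => ?_
  change _ ↔ (coord _ i (tensorOp M.J 1 z), coord _ i (-tensorOp M.J 1 w)) ∈ _
  rw [map_neg, coord_basisIncl_tensorOp_one, coord_basisIncl_tensorOp_one, mem_shiftGraph,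
    mem_shiftGraph, hM.mem_graph_adjoint]
  simp only [smul_apply, map_sub, map_smul, hJ, neg_sub, smul_neg, sub_neg_eq_add]
  rw [neg_add_eq_sub]

theorem LorentzianData.hasBoundedCommutator_prod (hM : M.IsLorentzianSpectralTriple)
    (hγ : M.IsGrading γ) (hF : F.IsCompactSpectralTriple)
    (hcl : (M.prod γ F).D.IsClosed) (z : B ⊗[ℂ] C) :
    HasBoundedCommutator (M.prod γ F).D ((M.prod γ F).π z) := by
  induction z with
  | zero => rw [map_zero]; exact HasBoundedCommutator.zero _
  | tmul a b =>
    obtain ⟨C, hC⟩ := exists_commutator_algTensor_add (hM.bounded_comm a) (hγ.comm a)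
      (hF.bounded_comm b)
    exact hasBoundedCommutator_closure hcl hC
  | add x y hx hy => rw [map_add]; exact hx.add hy

theorem LorentzianData.compact_resolvent_prod (hM : M.IsLorentzianSpectralTriple)
    (hγ : M.IsGrading γ) (hF : F.IsCompactSpectralTriple)
    (hl : ∀ i, (e i, (l i : ℂ) • e i) ∈ F.D.graph) (hfin : ∀ c, {i | |l i| ≤ c}.Finite) :
    ∃ S, IsInvSqrtOneAdd (angleSq (M.prod γ F).D) S ∧
      ∀ a ∈ (M.prod γ F).A, IsCompactOperator ((M.prod γ F).π a ∘L S) := by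
  obtain ⟨S, hS, hSc⟩ := hM.compact_resolvent
  have hV := isHilbertSum_basisIncl (H := H) e
  obtain ⟨W, R, hR, hWl, hinv⟩ := isInvSqrtOneAdd_sum hV hS l
  refine ⟨R, hinv _ ?_, fun a ha => ?_⟩
  · exact angleSq_graph_eq_sumGraph hV (fun x => DFunLike.congr_fun hγ.sq x)
      (fun _ _ h => neg_mem_graph_of_anticomm hγ.anticomm_D h)
      (fun _ _ h => hM.anticomm_adjoint hγ h) hS.isClosed (graph_prod_D hM hF hl)
      (graph_prod_D_adjoint hM hγ hF hl)
  · refine tensorIdeal_induction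
      (p := fun a => IsCompactOperator (tensorRep M.π F.π a ∘L R)) ?_ ?_ ?_ ha
    · rw [map_zero, ContinuousLinearMap.zero_comp]
      exact isCompactOperator_zero
    · intro a ha b
      rw [tensorRep_tmul]
      refine isCompactOperator_tensorOp_diagonal (R := fun i => S ∘L W i) (fun i => (hSc a ha).comp_clm (W i))
        (fun ε hε => (hfin ε⁻¹).subset fun i hi => ?_) hR
      have hi' : ε < ‖S ∘L W i‖ := hi
      change |l i| ≤ ε⁻¹
      rw [← one_div, le_div_iff₀ hε]
      exact (mul_le_mul_of_nonneg_left hi'.le (abs_nonneg _)).trans (hWl i)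
    · intro a b ha hb
      rw [map_add, ContinuousLinearMap.add_comp]
      exact ha.add hb

theorem LorentzianData.isTimeOperator_prod (hM : M.IsLorentzianSpectralTriple) {T : H →ₗ.[ℂ] H} (hT : M.IsTimeOperator T)
    (hTγ : opComp (bddOp γ) T = opComp T (bddOp γ)) (hF : F.IsCompactSpectralTriple)
    (hl : ∀ i, (e i, (l i : ℂ) • e i) ∈ F.D.graph) :
    (M.prod γ F).IsTimeOperator (algTensor T (bddOp (1 : K →L[ℂ] K))).closure := by
  have hV := isHilbertSum_basisIncl (H := H) e
  have hg := graph_closure_algTensor_one (e := e) hT.selfAdjoint.isClosed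
  have hD := graph_prod_D (γ := γ) hM hF hl
  set T' := (algTensor T (bddOp (1 : K →L[ℂ] K))).closure
  refine ⟨isSelfAdjoint_of_graph_eq_sumGraph hV hT.selfAdjoint hg, ?_, ?_, ?_⟩
  · obtain ⟨t, ht⟩ := hT.inv_sqrt_mem
    refine ⟨t ⊗ₜ 1, ?_⟩
    change IsInvSqrtOneAdd _ (tensorRep M.π F.π (t ⊗ₜ 1))
    rw [tensorRep_tmul, map_one]
    exact isInvSqrtOneAdd_tensorOp e hT.selfAdjoint ht hg
  · refine hV.dense_of_map_mem (U := fun _ => (opComm M.D T).domain) (fun _ => hT.dense_comm) ?_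
    intro i x hx
    obtain ⟨w, hw⟩ := LinearPMap.mem_domain_iff.1 hx
    obtain ⟨a, b, c, d, ha, hb, hc, hd, -⟩ := mem_graph_opComm.1 hw
    have memT : ∀ {a b}, (a, b) ∈ T.graph → (basisIncl H e i a, basisIncl H e i b) ∈ T'.graph :=
      fun hab => hg ▸ hV.map_mem_sumGraph hab
    have memD : ∀ {a b}, (a, b) ∈ M.D.graph → (basisIncl H e i a,
        basisIncl H e i (b + (l i : ℂ) • γ a)) ∈ (M.prod γ F).D.graph :=
      fun hab => hD ▸ hV.map_mem_sumGraph (add_mem_shiftGraph hab)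
    -- `T` must be applicable to `D x + l i • γ x`; commutation with `γ` puts `γ x` in the domain of
    -- `T`, with `T γ x = γ T x`.
    exact LinearPMap.mem_domain_iff.2 ⟨_, mem_graph_opComm.2 ⟨_, _, _, _, memT ha, memD hb, memD hc,
      memT (T.graph.add_mem hd (T.graph.smul_mem (l i : ℂ) (mem_graph_of_comm hTγ ha))), rfl⟩⟩
  · rw [LinearPMap.forall_apply_iff_graph (p := fun z w => (M.prod γ F).J z = -w)]
    intro z w hzw
    obtain ⟨a, b, c, d, ha, hb, hc, hd, rfl⟩ := mem_graph_opComm.1 hzw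
    rw [hg, mem_sumGraph] at ha hd
    rw [hD, mem_sumGraph] at hb hc
    refine hV.ext_coord fun i => ?_
    change coord _ i (tensorOp M.J 1 z) = _
    rw [coord_basisIncl_tensorOp_one, map_neg, map_sub]
    have hJ := LinearPMap.forall_apply_iff_graph (p := fun z w => M.J z = -w) |>.1 hT.J_eq
    -- Both products `D T` and `T D` lose the same term `l i • γ T x`, so the commutator is
    -- unchanged.
    refine hJ _ _ (mem_graph_opComm.2 ⟨_, _, _, _, ha i, mem_shiftGraph.1 (hb i),
      mem_shiftGraph.1 (hc i), T.graph.sub_mem (hd i)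
        (T.graph.smul_mem (l i : ℂ) (mem_graph_of_comm hTγ (ha i))), ?_⟩)
    simp only [smul_apply, Prod.smul_snd]
    abel

end Product

end

theorem theorem2p3
    {B H C K : Type*}
    [Ring B] [StarRing B] [Algebra ℂ B] [StarModule ℂ B]
    [NormedAddCommGroup H] [InnerProductSpace ℂ H] [CompleteSpace H]
    [Ring C] [StarRing C] [Algebra ℂ C] [StarModule ℂ C]
    [NormedAddCommGroup K] [InnerProductSpace ℂ K] [CompleteSpace K] [Nontrivial K]
    (M : LorentzianData B H) (hM : M.IsLorentzianSpectralTriple)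
    (γ : H →L[ℂ] H) (hγ : M.IsGrading γ)
    (T : H →ₗ.[ℂ] H) (hT : M.IsTimeOperator T)
    (hTγ : opComp (bddOp γ) T = opComp T (bddOp γ))
    (F : RiemannianData C K) (hF : F.IsCompactSpectralTriple) :
    (M.prod γ F).IsLorentzianSpectralTriple ∧
      (M.prod γ F).IsTimeOperator (algTensor T (bddOp (1 : K →L[ℂ] K))).closure := by
  obtain ⟨S, hS, hSc⟩ := hF.compact_resolvent
  obtain ⟨ι, e, l, hl, hfin⟩ := exists_eigenbasis hF.selfAdjoint hS hSc
  -- From `K ≠ 0` and unitality of the representation, `1 ≠ 0` in `C`; the slicing argument for the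
  -- missing identity needs this.
  have hC : Nontrivial C := (F.π : C →+* (K →L[ℂ] K)).domain_nontrivial
  have hcl : (M.prod γ F).D.IsClosed := by
    rw [LinearPMap.IsClosed, LorentzianData.graph_prod_D hM hF hl]
    exact isClosed_sumGraph fun i => isClosed_shiftGraph hM.isClosed_D _
  have htime := LorentzianData.isTimeOperator_prod hM hT hTγ hF hl
  refine ⟨?_, htime⟩
  exact
    { faithful := tensorRep_injective hM.faithful hF.faithful
      star_mem := fun a ha => star_mem_tensorIdeal hM.star_mem ha
      ideal := fun a ha b => tensorIdeal_mul_mem hM.ideal ha b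
      nonunital := tensorIdeal_no_unit hM.nonunital
      dense_domain := LorentzianData.dense_prod_D hM hF hl
      bounded_comm := LorentzianData.hasBoundedCommutator_prod hM hγ hF hcl
      compact_resolvent := LorentzianData.compact_resolvent_prod hM hγ hF hl hfin
      J_sq := by
        change tensorOp M.J 1 * tensorOp M.J 1 = 1
        rw [tensorOp_one_mul_one, hM.J_sq, tensorOp_one_one]
      J_adjoint := by
        change ContinuousLinearMap.adjoint (tensorOp M.J 1) = tensorOp M.J 1
        rw [tensorOp_adjoint, hM.J_adjoint, ContinuousLinearMap.one_def,
          ContinuousLinearMap.adjoint_id]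
      J_comm := commute_tensorOp_tensorRep hM.J_comm
      D_adjoint := LorentzianData.prod_D_adjoint hM hγ hF hl
      time := ⟨_, htime⟩ }
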